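/- Lemma 3.1. Let $T>0$, $\alpha\in(\tfrac12,1)$, and let $X=(X_t)_{t\in[0,T]}$ be a centered Gaussian process with continuous paths on a probability space $(\Omega,\mathcal F,\mathbb P)$, adapted to a filtration $\mathbb F=(\mathcal F_t)_{t\in[0,T]}$. For $u\in[0,T)$ let $Y_t=X_{t+u}-X_u$, $t\in[0,T-u]$, with $R_Y(t,s)=\mathbb E[Y_tY_s]$, $W_Y(t,s)=\mathbb E[(Y_t-Y_s)^2]$, $V_Y(t)=\mathbb E[Y_t^2]$. Assume $X\in\mathcal X^\alpha_T$, i.e. there is $\delta\in(0,T]$ such that for every $u\in[T-\delta,T)$: (1) $R_Y(s,t)>0$ for all $s,t\in(0,T-u]$; (2) there is $C>0$ with $\sup_{0\le s\le T-u-t}W_Y(t+s,s)\le Ct^{2\alpha}$ for all $t\in[0,T-u]$; (3) there are $c,\hat\delta>0$ with $V_Y(s)\ge cs^2$ for all $s\in[0,T-u]$ with $s\le\hat\delta$; (4) there is $\hat\delta>0$ with $\sup\{R_Y(s,s)/R_Y(t,s) : 0<t<2\hat\delta,\ t\le T-u,\ t/2\le s\le t\}<\infty$. Assume also the small ball condition: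 there are $C,\Delta>0$ and $\delta\in(0,T]$ such that for all $s<t$ in $[T-\delta,T]$ with $t-s\le\Delta$ and all $0<\epsilon\le(t-s)^\alpha$, $$\mathbb P\Big(\sup_{s\le u\le t}|X_u-X_s|\le\epsilon\Big)\le\exp\big(-C(t-s)\epsilon^{-1/\alpha}\big).$$ Then there are an $\mathbb F$-adapted process $\phi_T$ on $[0,T]$ and $\beta\in(0,1)$ such that, almost surely, the integral $\int_0^s\phi_T(r)\,dX_r$ exists for every $s\in[0,T)$ as a generalized Lebesgue–Stieltjes integral of order $\beta$, and $$\lim_{s\to T-}\int_0^s\phi_T(r)\,dX_r=+\infty .$$ Here, for measurable $f$ and continuous $g$ on $[0,t]$, the generalized Lebesgue–Stieltjes integral is $$\int_0^t f\,dg=-\int_0^t (D^\beta_{0+}f)(s)\,(D^{1-\beta}_{t-}g_{t-})(s)\,ds,\qquad g_{t-}(s)=g(s)-g(t),$$ $$(D^\beta_{0+}f)(s)=\tfrac1{\Gamma(1-\beta)}\Big(\tfrac{f(s)}{s^\beta}+\beta\int_0^s\tfrac{f(s)-f(u)}{(s-u)^{1+\beta}}du\Big),\qquad (D^{\beta}_{t-}h)(s)=\tfrac1{\Gamma(1-\beta)}\Big(\tfrac{h(s)}{(t-s)^\beta}+\beta\int_s^t\tfrac{h(s)-h(u)}{(u-s)^{1+\beta}}du\Big)$$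 (real normalisation, so that $\int_0^t1\,dg=g(t)-g(0)$). It exists if $$\int_0^t\frac{|f(s)|}{s^\beta}ds+\int_0^t\int_0^s\frac{|f(u)-f(s)|}{(s-u)^{1+\beta}}\,du\,ds<\infty,$$ there is $a\in[0,t]$ such that $f=0$ on $[0,a)$ and $$\sup_{a\le s<r\le t}\Big(\frac{|g(r)-g(s)|}{(r-s)^{1-\beta}}+\int_s^r\frac{|g(u)-g(s)|}{(u-s)^{2-\beta}}du\Big)<\infty,$$ and the product $(D^\beta_{0+}f)(D^{1-\beta}_{t-}g_{t-})$ is Lebesgue integrable on $[0,t]$, where it is understood to be $0$ on $[0,a)$, $D^\beta_{0+}f$ being $0$ there. -/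

import Mathlib

open MeasureTheory ProbabilityTheory Set Filter Topology
open scoped ENNReal

noncomputable section

namespace GaussianRep

variable {Ω : Type*} {mΩ : MeasurableSpace Ω}

/-! ### The class of Gaussian processes

Processes on `[0, T]` are written `X : ℝ → Ω → ℝ`; only the values at times in `[0, T]` matter. -/

/-- Covariance `R_X(t, s) = E[X_t X_s]` of a centered process. -/
def cov (P : Measure Ω) (X : ℝ → Ω → ℝ) (t s : ℝ) : ℝ := ∫ ω, X t ω * X s ω ∂P

/-- Incremental variance `W_X(t, s) = E[(X_t - X_s)²]`. -/
def incVar (P : Measure Ω) (X : ℝ → Ω → ℝ) (t s : ℝ) : ℝ := ∫ ω, (X t ω - X s ω) ^ 2 ∂P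

/-- Variance `V_X(t) = E[X_t²]` of a centered process. -/
def var (P : Measure Ω) (X : ℝ → Ω → ℝ) (t : ℝ) : ℝ := ∫ ω, X t ω ^ 2 ∂P

/-- The incremental process `Y_t = X_{t+u} - X_u`. -/
def incProc (X : ℝ → Ω → ℝ) (u : ℝ) : ℝ → Ω → ℝ := fun t ω => X (t + u) ω - X u ω

/-- `X` is a centered Gaussian process on `[0, T]` with continuous paths. -/
structure IsCenteredContGaussian (P : Measure Ω) (T : ℝ) (X : ℝ → Ω → ℝ) : Prop where
  gaussian : IsGaussianProcess (fun t : Icc (0 : ℝ) T => X t) P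
  centered : ∀ t ∈ Icc (0 : ℝ) T, ∫ ω, X t ω ∂P = 0
  continuous : ∀ ω, ContinuousOn (fun t => X t ω) (Icc 0 T)

/-- The four covariance conditions, for a process `Y` on `[0, L]`. Each bound on a supremum is
written as a bound on all its members. -/
structure CovarianceConditions (P : Measure Ω) (α L : ℝ) (Y : ℝ → Ω → ℝ) : Prop where
  cov_pos : ∀ s ∈ Ioc (0 : ℝ) L, ∀ t ∈ Ioc (0 : ℝ) L, 0 < cov P Y s t
  incVar_le : ∃ C : ℝ, 0 < C ∧ ∀ t ∈ Icc (0 : ℝ) L, ∀ s ∈ Icc (0 : ℝ) (L - t),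
    incVar P Y (t + s) s ≤ C * t ^ (2 * α)
  le_var : ∃ c d : ℝ, 0 < c ∧ 0 < d ∧ ∀ s ∈ Icc (0 : ℝ) L, s ≤ d → c * s ^ 2 ≤ var P Y s
  ratio_bdd : ∃ d M : ℝ, 0 < d ∧ ∀ t ∈ Ioc (0 : ℝ) L, t < 2 * d →
    ∀ s ∈ Icc (t / 2) t, cov P Y s s / cov P Y t s ≤ M

/-- The class `𝒳^α_T`. -/
structure ClassX (P : Measure Ω) (α T : ℝ) (X : ℝ → Ω → ℝ) : Prop where
  base : IsCenteredContGaussian P T X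
  conditions : ∃ δ : ℝ, 0 < δ ∧ δ ≤ T ∧ ∀ u ∈ Ico (T - δ) T,
    CovarianceConditions P α (T - u) (incProc X u)

/-- The small ball assumption: close to `T`, on time intervals `[s, t]` of length at most `Δ`,
`P(sup_{s ≤ u ≤ t} |X_u - X_s| ≤ ε) ≤ exp(-C (t - s) ε^{-1/α})` provided `0 < ε ≤ (t - s)^α`. -/
def SmallBall (P : Measure Ω) (α T : ℝ) (X : ℝ → Ω → ℝ) : Prop :=
  ∃ C δ Δ : ℝ, 0 < C ∧ 0 < δ ∧ δ ≤ T ∧ 0 < Δ ∧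
    ∀ s ∈ Icc (T - δ) T, ∀ t ∈ Icc (T - δ) T, s < t → t - s ≤ Δ →
      ∀ ε : ℝ, 0 < ε → ε ≤ (t - s) ^ α →
        P.real {ω | ∀ u ∈ Icc s t, |X u ω - X s ω| ≤ ε}
          ≤ Real.exp (-(C * (t - s) * ε ^ (-(1 / α))))

/-! ### The generalized Lebesgue–Stieltjes integral -/

/-- The norm of the fractional Besov space `W^β_1([a, b])`, possibly infinite. -/
def besovNorm₁ (β a b : ℝ) (g : ℝ → ℝ) : ℝ≥0∞ :=
  ⨆ (s : ℝ) (t : ℝ) (_ : a ≤ s) (_ : s < t) (_ : t ≤ b),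
    (ENNReal.ofReal (|g t - g s| / (t - s) ^ β)
      + ∫⁻ u in Ioo s t, ENNReal.ofReal (|g u - g s| / (u - s) ^ (1 + β)))

/-- The norm of the fractional Besov space `W^β_2([0, t])`, possibly infinite. -/
def besovNorm₂ (β t : ℝ) (f : ℝ → ℝ) : ℝ≥0∞ :=
  (∫⁻ s in Ioo 0 t, ENNReal.ofReal (|f s| / s ^ β))
    + ∫⁻ s in Ioo 0 t, ∫⁻ u in Ioo 0 s, ENNReal.ofReal (|f u - f s| / (s - u) ^ (1 + β))

/-- Membership in `W^β_1([a, b])`. -/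
def MemBesov₁ (β a b : ℝ) (g : ℝ → ℝ) : Prop :=
  AEMeasurable g (volume.restrict (Icc a b)) ∧ besovNorm₁ β a b g < ∞

/-- Membership in `W^β_2([0, t])`. -/
def MemBesov₂ (β t : ℝ) (f : ℝ → ℝ) : Prop :=
  AEMeasurable f (volume.restrict (Icc 0 t)) ∧ besovNorm₂ β t f < ∞

/-- The fractional derivative `D^β_{0+} f` in its Weyl representation. -/
def weylLeft (β : ℝ) (f : ℝ → ℝ) (s : ℝ) : ℝ :=
  1 / Real.Gamma (1 - β) *
    (f s / s ^ β + β * ∫ u in (0 : ℝ)..s, (f s - f u) / (s - u) ^ (β + 1))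

/-- The fractional derivative `D^β_{t-} h` in its Weyl representation, without the constant
factor `(-1)^{-β}`, see `glsIntegral`. -/
def weylRight (β t : ℝ) (h : ℝ → ℝ) (s : ℝ) : ℝ :=
  1 / Real.Gamma (1 - β) *
    (h s / (t - s) ^ β + β * ∫ u in s..t, (h s - h u) / (u - s) ^ (β + 1))

/-- The integrand of the generalized Lebesgue–Stieltjes integral `∫_0^t f dg`, where
`g_{t-}(s) = g(s) - g(t)` (`g` is continuous). -/
def glsIntegrand (β t : ℝ) (f g : ℝ → ℝ) (s : ℝ) : ℝ :=
  weylLeft β f s * weylRight (1 - β) t (fun r => g r - g t) s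

/-- The generalized Lebesgue–Stieltjes integral `∫_0^t f dg`. The sign is the product of the
constants `(-1)^β` and `(-1)^{1-β}` of the complex normalisation, so that
`∫_0^t 1 dg = g(t) - g(0)`. -/
def glsIntegral (β t : ℝ) (f g : ℝ → ℝ) : ℝ := -∫ s in (0 : ℝ)..t, glsIntegrand β t f g s

/-- The integral `∫_0^t f dg` exists as a generalized Lebesgue–Stieltjes integral of order `β`:
`f ∈ W^β_2([0, t])`, the continuous function `g` is in `W^{1-β}_1` on `[a, t]`, where
`f` vanishes on `[0, a)` (`a = 0` is the usual condition; where `f` vanishes from time `0` on,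
so does `D^β_{0+} f`, and nothing but continuity is needed of `g` there), and the product of
the fractional derivatives is Lebesgue integrable. -/
structure GLSIntegrable (β t : ℝ) (f g : ℝ → ℝ) : Prop where
  order : β ∈ Ioo (0 : ℝ) 1
  integrand_mem : MemBesov₂ β t f
  integrator_cont : ContinuousOn g (Icc 0 t)
  integrator_mem : ∃ a ∈ Icc (0 : ℝ) t, (∀ s ∈ Ico 0 a, f s = 0) ∧ MemBesov₁ (1 - β) a t g
  integrable : IntervalIntegrable (glsIntegrand β t f g) volume 0 t

end GaussianRep

end

namespace GaussianRep

/-! ### The Beta integral with complementary exponents -/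

/-! Since the variance bound has exponent `2 * α > 1`, almost every path is Hölder of some order `γ
> 1/2` on `[T - δ, T]`, so its quadratic variation along fine partitions is negligible. On a block
`[t_n, t_{n+1})`, holding `2 a_n (X - X_{t_n})`, sampled at the beginning of each cell, therefore
gains `a_n (X_{t_{n+1}} - X_{t_n})²` up to a small error. Increments over blocks have positive
variance, so `ε_n` can be chosen with `P(|X_{t_{n+1}} - X_{t_n}| < ε_n) ≤ 2^{-n}`. With `a_n =
ε_n^{-2}`, Borel–Cantelli makes the squared term at least `1` in all but finitely many blocks. The
mesh is chosen deterministically so that the error in block `n` is at most `K² 2^{-n}`, where `K` is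
the random Hölder constant. This also bounds the loss inside an unfinished block, so the gain tends
to infinity as time tends to `T`, and not only along the block times (`le_blockGain`,
`tendsto_sum_blockGain`).

The remaining work is to show that the fractional integral of a step function is the expected sum of
increments (`hasGLSIntegral_indicator_Ici`). The left derivative of the indicator of `[p, ∞)` is a
power of `s - p`, and integrating the right derivative of a Hölder function against that power
returns the increment (`integral_rpow_mul_weylRight`). For smooth functions this is Fubini and a
Beta integral; mollification gives the Hölder case. Path regularity is Kolmogorov's criterion
(`ae_holder_of_moments`) applied to Gaussian moments. -/

theorem integral_rpow_mul_rpow {β : ℝ} (h0 : 0 < β) (h1 : β < 1) {a v : ℝ} (hav : a < v) :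
    ∫ s in a..v, (s - a) ^ (-β) * (v - s) ^ (β - 1) = Real.Gamma (1 - β) * Real.Gamma β := by
  have hL : 0 < v - a := sub_pos.2 hav
  have e1 : ∫ s in a..v, (s - a) ^ (-β) * (v - s) ^ (β - 1)
      = ∫ x in (0 : ℝ)..(v - a), x ^ (-β) * ((v - a) - x) ^ (β - 1) := by
    rw [← sub_self a, ← intervalIntegral.integral_comp_sub_right
      (fun x => x ^ (-β) * ((v - a) - x) ^ (β - 1))]
    refine intervalIntegral.integral_congr fun x _ => ?_
    simp only [sub_sub_sub_cancel_right]
  have e2 := Complex.betaIntegral_scaled ((1 - β : ℝ) : ℂ) (β : ℂ) hL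
  have e3 := Complex.Gamma_mul_Gamma_eq_betaIntegral (s := ((1 - β : ℝ) : ℂ)) (t := (β : ℂ))
    (by simpa using h1) (by simpa using h0)
  -- The exponents add up to one, so the scaling factor is a zeroth power and the value does not
  -- depend on the interval.
  have hs : ((1 - β : ℝ) : ℂ) + β = 1 := by push_cast; ring
  rw [hs, Complex.Gamma_one, one_mul] at e3
  rw [hs, sub_self, Complex.cpow_zero, one_mul, ← e3, Complex.Gamma_ofReal,
    Complex.Gamma_ofReal] at e2
  rw [e1]
  apply Complex.ofReal_injective
  rw [← intervalIntegral.integral_ofReal, Complex.ofReal_mul, ← e2]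
  refine intervalIntegral.integral_congr fun x hx => ?_
  rw [uIcc_of_le hL.le] at hx
  simp only [Complex.ofReal_mul]
  rw [Complex.ofReal_cpow hx.1, Complex.ofReal_cpow (sub_nonneg.2 hx.2)]
  push_cast
  congr 2
  ring

theorem intervalIntegrable_rpow_mul_rpow {β : ℝ} (h0 : 0 < β) (h1 : β < 1) {a v : ℝ}
    (hav : a < v) :
    IntervalIntegrable (fun s => (s - a) ^ (-β) * (v - s) ^ (β - 1)) volume a v := by
  -- A non-integrable function has integral zero by convention, so a nonzero value forces
  -- integrability.
  apply intervalIntegral.intervalIntegrable_of_integral_ne_zero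
  rw [integral_rpow_mul_rpow h0 h1 hav]
  exact (mul_pos (Real.Gamma_pos_of_pos (sub_pos.2 h1)) (Real.Gamma_pos_of_pos h0)).ne'

theorem intervalIntegrable_sub_rpow {r : ℝ} (hr : -1 < r) (c a b : ℝ) :
    IntervalIntegrable (fun u => (u - c) ^ r) volume a b := by
  have := (intervalIntegral.intervalIntegrable_rpow' hr (a := a - c) (b := b - c)).comp_sub_right c
  simpa using this

theorem integral_sub_rpow {r : ℝ} (hr : -1 < r) (s t : ℝ) :
    ∫ u in s..t, (u - s) ^ r = (t - s) ^ (r + 1) / (r + 1) := by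
  rw [intervalIntegral.integral_comp_sub_right (fun u => u ^ r), integral_rpow (Or.inl hr), sub_self,
    Real.zero_rpow (by linarith), sub_zero]

theorem measurable_parametric_intervalIntegral {F : ℝ → ℝ → ℝ} (hF : Measurable F.uncurry) (t : ℝ) :
    Measurable fun s => ∫ u in s..t, F s u := by
  simp only [intervalIntegral]
  have h1 : Measurable fun s => ∫ u in Ioc s t, F s u := by
    have : (fun s => ∫ u in Ioc s t, F s u)
        = fun s => ∫ u, ({p : ℝ × ℝ | p.1 < p.2 ∧ p.2 ≤ t}.indicator F.uncurry) (s, u) := by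
      ext s
      rw [← integral_indicator measurableSet_Ioc]
      rfl
    rw [this]
    refine StronglyMeasurable.measurable (StronglyMeasurable.integral_prod_right
      (hF.indicator ?_).stronglyMeasurable)
    exact (measurableSet_lt measurable_fst measurable_snd).inter
      (measurableSet_le measurable_snd measurable_const)
  have h2 : Measurable fun s => ∫ u in Ioc t s, F s u := by
    have : (fun s => ∫ u in Ioc t s, F s u)
        = fun s => ∫ u, ({p : ℝ × ℝ | t < p.2 ∧ p.2 ≤ p.1}.indicator F.uncurry) (s, u) := by
      ext s
      rw [← integral_indicator measurableSet_Ioc]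
      rfl
    rw [this]
    refine StronglyMeasurable.measurable (StronglyMeasurable.integral_prod_right
      (hF.indicator ?_).stronglyMeasurable)
    exact (measurableSet_lt measurable_const measurable_snd).inter
      (measurableSet_le measurable_snd measurable_fst)
  exact h1.sub h2

theorem measurable_weylRight (β t : ℝ) {h : ℝ → ℝ} (hh : Measurable h) :
    Measurable (weylRight β t h) := by
  have hF : Measurable (Function.uncurry fun s u : ℝ => (h s - h u) / (u - s) ^ (β + 1)) := by
    simp only [Function.uncurry_def]
    fun_prop
  have := measurable_parametric_intervalIntegral hF t
  unfold weylRight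
  fun_prop

/-! ### Right-sided fractional derivatives of Hölder functions -/

theorem abs_div_rpow_le {K lam r x d : ℝ} (hd : 0 ≤ d) (hl : 0 < lam) (hr : lam - r ≠ 0)
    (h : |x| ≤ K * d ^ lam) : |x / d ^ r| ≤ K * d ^ (lam - r) := by
  rcases hd.eq_or_lt with rfl | hd
  · have : x = 0 := by simpa [Real.zero_rpow hl.ne'] using h
    rw [this, Real.zero_rpow hr]
    simp
  · rw [abs_div, abs_of_pos (Real.rpow_pos_of_pos hd r), Real.rpow_sub hd, ← mul_div_assoc]
    gcongr

/-- Both terms scale like `(t - s) ^ (lam - (1 - β))`; the singularity `(u - s) ^ (lam + β - 2)` is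
integrable because `lam + β > 1`. The constant depends on `h` only through `K`, so the bound
dominates a whole family of mollifications. -/
theorem abs_weylRight_le {β lam K t : ℝ} (h0 : 0 < β) (h1 : β < 1) (hl : 0 < lam + β - 1)
    {h : ℝ → ℝ} (hK : ∀ x y, |h x - h y| ≤ K * |x - y| ^ lam) (ht : h t = 0) {s : ℝ} (hs : s ≤ t) :
    |weylRight (1 - β) t h s|
      ≤ 1 / Real.Gamma β * (K * (1 + (1 - β) / (lam + β - 1))) * (t - s) ^ (lam + β - 1) := by
  have hts : 0 ≤ t - s := sub_nonneg.2 hs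
  have hG : 0 < Real.Gamma β := Real.Gamma_pos_of_pos h0
  have b1 : |h s / (t - s) ^ (1 - β)| ≤ K * (t - s) ^ (lam + β - 1) := by
    have := abs_div_rpow_le (K := K) (lam := lam) (r := 1 - β) (x := h s) hts
      (by linarith) (by linarith [hl]) (by have := hK s t; rwa [ht, sub_zero, abs_sub_comm, abs_of_nonneg hts] at this)
    rwa [show lam - (1 - β) = lam + β - 1 by ring] at this
  have b2 : |∫ u in s..t, (h s - h u) / (u - s) ^ (1 - β + 1)|
      ≤ K * ((t - s) ^ (lam + β - 1) / (lam + β - 1)) := by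
    have hint := intervalIntegrable_sub_rpow (r := lam + β - 2) (by linarith) s s t
    have := intervalIntegral.norm_integral_le_of_norm_le (μ := volume) hs
      (f := fun u => (h s - h u) / (u - s) ^ (1 - β + 1)) (g := fun u => K * (u - s) ^ (lam + β - 2))
      (Eventually.of_forall fun u hu => ?_) (hint.const_mul K)
    · rw [intervalIntegral.integral_const_mul, integral_sub_rpow (by linarith)] at this
      rw [show lam + β - 2 + 1 = lam + β - 1 by ring] at this
      simpa using this
    · rw [Real.norm_eq_abs, show lam + β - 2 = lam - (1 - β + 1) by ring]
      have hus : 0 < u - s := sub_pos.2 hu.1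
      rw [abs_div, abs_of_pos (Real.rpow_pos_of_pos hus _), Real.rpow_sub hus, ← mul_div_assoc]
      gcongr
      have := hK s u
      rwa [abs_sub_comm s u, abs_of_pos hus] at this
  unfold weylRight
  rw [show 1 - (1 - β) = β by ring, abs_mul, abs_of_pos (one_div_pos.2 hG), mul_assoc]
  gcongr
  calc _ ≤ |h s / (t - s) ^ (1 - β)| + |(1 - β) * ∫ u in s..t, (h s - h u) / (u - s) ^ (1 - β + 1)| :=
        abs_add_le _ _
    _ ≤ K * (t - s) ^ (lam + β - 1) + (1 - β) * (K * ((t - s) ^ (lam + β - 1) / (lam + β - 1))) := by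
        rw [abs_mul, abs_of_pos (sub_pos.2 h1)]
        have := sub_pos.2 h1
        gcongr
    _ = _ := by ring

/-- Integration by parts with the antiderivative `(h s - h u) * (u - s) ^ (β - 1)`. Its boundary
value at `u = s` vanishes since `h` is Lipschitz on `[s, t]` and `β > 0`; the one at `u = t` is the
non-integral term of the derivative. -/
theorem weylRight_eq_of_hasDerivAt {β t : ℝ} (h0 : 0 < β) {h h' : ℝ → ℝ}
    (hd : ∀ x, HasDerivAt h (h' x) x) (hc : Continuous h') (ht : h t = 0) {s : ℝ} (hs : s < t) :
    weylRight (1 - β) t h s = -(1 / Real.Gamma β * ∫ u in s..t, h' u * (u - s) ^ (β - 1)) := by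
  obtain ⟨M, hM⟩ : ∃ M, ∀ u ∈ Icc s t, |h' u| ≤ M :=
    (isCompact_Icc.exists_bound_of_continuousOn hc.continuousOn)
  have hM0 : 0 ≤ M := (abs_nonneg _).trans (hM s ⟨le_rfl, hs.le⟩)
  have hlip : ∀ u ∈ Icc s t, |h s - h u| ≤ M * (u - s) := by
    intro u hu
    have := Convex.norm_image_sub_le_of_norm_hasDerivWithin_le (f := h) (f' := h') (C := M)
      (s := Icc s t) (x := u) (y := s) (fun x hx => (hd x).hasDerivWithinAt)
      (fun x hx => hM x hx) (convex_Icc s t) hu ⟨le_rfl, hs.le⟩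
    simpa [abs_sub_comm s u, abs_of_nonneg (sub_nonneg.2 hu.1)] using this
  have hhc : Continuous h := continuous_iff_continuousAt.2 fun x => (hd x).continuousAt
  have hi1 : IntervalIntegrable (fun u => h' u * (u - s) ^ (β - 1)) volume s t :=
    (intervalIntegrable_sub_rpow (by linarith) s s t).continuousOn_mul hc.continuousOn
  have hi2 : IntervalIntegrable (fun u => (h s - h u) / (u - s) ^ (1 - β + 1)) volume s t := by
    refine ((intervalIntegrable_sub_rpow (r := β - 1) (by linarith) s s t).const_mul M).mono_fun
      (Measurable.aestronglyMeasurable (by have := hhc.measurable; fun_prop)) ?_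
    rw [uIoc_of_le hs.le]
    refine (ae_restrict_mem measurableSet_Ioc).mono fun u hu => ?_
    have hus : 0 < u - s := sub_pos.2 hu.1
    have hp := Real.rpow_pos_of_pos hus (β - 1)
    simp only [Real.norm_eq_abs]
    rw [abs_div, abs_of_pos (Real.rpow_pos_of_pos hus _),
      abs_of_nonneg (mul_nonneg hM0 hp.le), div_le_iff₀ (Real.rpow_pos_of_pos hus _), mul_assoc,
      ← Real.rpow_add hus, show β - 1 + (1 - β + 1) = 1 by ring, Real.rpow_one]
    exact hlip u ⟨hu.1.le, hu.2⟩
  have key := intervalIntegral.integral_eq_sub_of_hasDerivAt_of_le hs.le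
    (f := fun u => (h s - h u) * (u - s) ^ (β - 1))
    (f' := fun u => (β - 1) * ((h s - h u) / (u - s) ^ (1 - β + 1)) - h' u * (u - s) ^ (β - 1))
    ?_ ?_ ((hi2.const_mul _).sub hi1)
  · rw [intervalIntegral.integral_sub (hi2.const_mul _) hi1, intervalIntegral.integral_const_mul,
      ht] at key
    simp only [sub_zero, sub_self, zero_mul] at key
    unfold weylRight
    rw [show 1 - (1 - β) = β by ring, ← mul_neg]
    congr 1
    rw [show β - 1 = -(1 - β) by ring, Real.rpow_neg (sub_nonneg.2 hs.le), ← div_eq_mul_inv] at key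
    rw [show β - 1 = -(1 - β) by ring]
    linarith
  · intro u hu
    rcases hu.1.eq_or_lt with rfl | hlt
    · have hz : Tendsto (fun u => M * (u - s) ^ β) (𝓝[Icc s t] s) (𝓝 0) := by
        have : Continuous fun u : ℝ => M * (u - s) ^ β :=
          continuous_const.mul ((continuous_id.sub continuous_const).rpow_const fun _ => Or.inr h0.le)
        simpa [Real.zero_rpow h0.ne'] using (this.tendsto s).mono_left nhdsWithin_le_nhds
      show Tendsto _ _ _
      simp only [sub_self, zero_mul]
      refine squeeze_zero_norm' ?_ hz
      filter_upwards [self_mem_nhdsWithin] with u hu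
      rcases hu.1.eq_or_lt with rfl | hlt
      · simp [Real.zero_rpow h0.ne']
      · have hus : 0 < u - s := sub_pos.2 hlt
        rw [Real.norm_eq_abs, abs_mul, abs_of_pos (Real.rpow_pos_of_pos hus _)]
        calc _ ≤ M * (u - s) * (u - s) ^ (β - 1) := by
              gcongr
              exact hlip u hu
          _ = _ := by
              rw [mul_assoc, mul_comm (u - s), ← Real.rpow_add_one hus.ne', sub_add_cancel]
    · refine ContinuousAt.continuousWithinAt ?_
      refine (continuousAt_const.sub hhc.continuousAt).mul
        (ContinuousAt.rpow_const (by fun_prop) (Or.inl (sub_pos.2 hlt).ne'))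
  · intro u hu
    have hus : 0 < u - s := sub_pos.2 hu.1
    have d1 : HasDerivAt (fun u => (u - s) ^ (β - 1)) (1 * (β - 1) * (u - s) ^ (β - 1 - 1)) u :=
      ((hasDerivAt_id u).sub_const s).rpow_const (Or.inl hus.ne')
    have d2 := ((hd u).const_sub (h s)).mul d1
    refine d2.congr_deriv ?_
    rw [div_eq_mul_inv, ← Real.rpow_neg hus.le, show -(1 - β + 1) = β - 1 - 1 by ring]
    ring

/-- Fubini on the triangle `s < u`: for fixed `u` the integral over `s` is the Beta integral on `[a,
u]`, which is the same constant for every `u`. -/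
theorem integral_rpow_mul_integral_rpow_mul {β : ℝ} (h0 : 0 < β) (h1 : β < 1) {a t : ℝ}
    (hat : a < t) {f : ℝ → ℝ} (hf : Continuous f) :
    ∫ s in a..t, (s - a) ^ (-β) * ∫ u in s..t, f u * (u - s) ^ (β - 1)
      = Real.Gamma (1 - β) * Real.Gamma β * ∫ u in a..t, f u := by
  set B := Real.Gamma (1 - β) * Real.Gamma β
  set μ := (volume : Measure ℝ).restrict (Ioc a t)
  let G : ℝ → ℝ → ℝ := fun s u =>
    (Iio u).indicator (fun s => (s - a) ^ (-β) * (u - s) ^ (β - 1)) s * f u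
  have hGm : Measurable G.uncurry := by
    have : G.uncurry = fun p : ℝ × ℝ => {p : ℝ × ℝ | p.1 < p.2}.indicator
        (fun p : ℝ × ℝ => (p.1 - a) ^ (-β) * (p.2 - p.1) ^ (β - 1)) p * f p.2 := rfl
    rw [this]
    have hf' := hf.measurable
    refine Measurable.mul (Measurable.indicator (by fun_prop)
      (measurableSet_lt measurable_fst measurable_snd)) (by fun_prop)
  have hinter : ∀ u ∈ Ioc a t, Ioc a t ∩ Iio u = Ioo a u := fun u hu => by
    ext s
    simp only [mem_inter_iff, mem_Ioc, mem_Iio, mem_Ioo]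
    exact ⟨fun h => ⟨h.1.1, h.2⟩, fun h => ⟨⟨h.1, h.2.le.trans hu.2⟩, h.2⟩⟩
  have hIntu : ∀ u ∈ Ioc a t,
      Integrable ((Iio u).indicator fun s => (s - a) ^ (-β) * (u - s) ^ (β - 1)) μ := by
    intro u hu
    rw [integrable_indicator_iff measurableSet_Iio, IntegrableOn, Measure.restrict_restrict
      measurableSet_Iio, inter_comm, hinter u hu]
    exact ((intervalIntegrable_rpow_mul_rpow h0 h1 hu.1).1).mono_set Ioo_subset_Ioc_self
  have hvalu : ∀ u ∈ Ioc a t,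
      ∫ s, (Iio u).indicator (fun s => (s - a) ^ (-β) * (u - s) ^ (β - 1)) s ∂μ = B := by
    intro u hu
    rw [integral_indicator measurableSet_Iio, Measure.restrict_restrict
      measurableSet_Iio, inter_comm, hinter u hu, ← integral_Ioc_eq_integral_Ioo,
      ← intervalIntegral.integral_of_le hu.1.le, integral_rpow_mul_rpow h0 h1 hu.1]
  have hGi : Integrable G.uncurry (μ.prod μ) := by
    rw [integrable_prod_iff' hGm.aestronglyMeasurable]
    refine ⟨(ae_restrict_mem measurableSet_Ioc).mono fun u hu => (hIntu u hu).mul_const (f u), ?_⟩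
    have : Integrable (fun u => B * ‖f u‖) μ := by
      have := (hf.norm.intervalIntegrable (μ := volume) a t).1
      exact Integrable.const_mul this B
    refine this.congr ((ae_restrict_mem measurableSet_Ioc).mono fun u hu => ?_)
    simp only [Function.uncurry, G, norm_mul]
    rw [integral_mul_const, ← hvalu u hu]
    congr 1
    refine integral_congr_ae ((ae_restrict_mem measurableSet_Ioc).mono fun s hs => ?_)
    refine (Real.norm_of_nonneg (indicator_apply_nonneg fun hsu => ?_)).symm
    have h2 : 0 ≤ u - s := sub_nonneg.2 (mem_Iio.1 hsu).le
    exact mul_nonneg (Real.rpow_nonneg (sub_nonneg.2 hs.1.le) _) (Real.rpow_nonneg h2 _)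
  have hswap := integral_integral_swap hGi
  rw [intervalIntegral.integral_of_le hat.le, intervalIntegral.integral_of_le hat.le]
  rw [← integral_const_mul]
  calc _ = ∫ s, ∫ u, G s u ∂μ ∂μ := by
        refine integral_congr_ae ((ae_restrict_mem measurableSet_Ioc).mono fun s hs => ?_)
        simp only
        rw [intervalIntegral.integral_of_le hs.2, ← integral_const_mul]
        have : (fun u => G s u) = (Ioi s).indicator
            fun u => (s - a) ^ (-β) * (f u * (u - s) ^ (β - 1)) := by
          ext u
          by_cases h : s < u <;> simp [G, indicator, h]
          ring
        rw [this, integral_indicator measurableSet_Ioi, Measure.restrict_restrict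
          measurableSet_Ioi, inter_comm, Ioc_inter_Ioi, max_eq_right hs.1.le]
    _ = _ := hswap
    _ = _ := by
        refine integral_congr_ae ((ae_restrict_mem measurableSet_Ioc).mono fun u hu => ?_)
        simp only [G]
        rw [integral_mul_const, hvalu u hu]

/-! ### Mollification -/

/-- The average of `g` over `[s, s + e]`. -/
noncomputable def rightAverage (e : ℝ) (g : ℝ → ℝ) (s : ℝ) : ℝ := e⁻¹ * ∫ u in s..s + e, g u

theorem hasDerivAt_rightAverage (e : ℝ) {g : ℝ → ℝ} (hg : Continuous g) (s : ℝ) :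
    HasDerivAt (rightAverage e g) (e⁻¹ * (g (s + e) - g s)) s := by
  have hP : ∀ x, HasDerivAt (fun x => ∫ u in (0 : ℝ)..x, g u) (g x) x := fun x =>
    intervalIntegral.integral_hasDerivAt_right (hg.intervalIntegrable _ _)
      (hg.stronglyMeasurableAtFilter _ _) hg.continuousAt
  have : rightAverage e g
      = fun s => e⁻¹ * ((∫ u in (0 : ℝ)..s + e, g u) - ∫ u in (0 : ℝ)..s, g u) := by
    ext s
    rw [rightAverage, intervalIntegral.integral_interval_sub_left] <;>
      exact hg.intervalIntegrable _ _
  rw [this]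
  exact (((hP (s + e)).comp_add_const s e).sub (hP s)).const_mul _

theorem rightAverage_eq {e : ℝ} (he : e ≠ 0) (g : ℝ → ℝ) (s : ℝ) :
    rightAverage e g s = ∫ w in (0 : ℝ)..1, g (s + e * w) := by
  rw [rightAverage, intervalIntegral.integral_comp_add_mul (fun x => g x) he]
  simp

/-- The mollification is an average of translates of `g`, so it inherits the Hölder constant,
uniformly in `e`. -/
theorem abs_rightAverage_sub_le {e K lam : ℝ} (he : 0 < e) {g : ℝ → ℝ} (hg : Continuous g)
    (hK : ∀ x y, |g x - g y| ≤ K * |x - y| ^ lam) (x y : ℝ) :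
    |rightAverage e g x - rightAverage e g y| ≤ K * |x - y| ^ lam := by
  rw [rightAverage_eq he.ne', rightAverage_eq he.ne', ← intervalIntegral.integral_sub]
  · have := intervalIntegral.norm_integral_le_of_norm_le_const (a := 0) (b := 1)
      (f := fun w => g (x + e * w) - g (y + e * w)) (C := K * |x - y| ^ lam) fun w _ => by
        simpa using hK (x + e * w) (y + e * w)
    simpa using this
  all_goals exact (by fun_prop : Continuous _).intervalIntegrable _ _

theorem tendsto_rightAverage {g : ℝ → ℝ} (hg : Continuous g) (s : ℝ) :
    Tendsto (fun n : ℕ => rightAverage (1 / ((n : ℝ) + 1)) g s) atTop (𝓝 (g s)) := by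
  have hP : HasDerivAt (fun x => ∫ u in s..x, g u) (g s) s :=
    intervalIntegral.integral_hasDerivAt_right (hg.intervalIntegrable _ _)
      (hg.stronglyMeasurableAtFilter _ _) hg.continuousAt
  have h1 := hP.tendsto_slope_zero
  have h2 : Tendsto (fun n : ℕ => 1 / ((n : ℝ) + 1)) atTop (𝓝[≠] 0) :=
    tendsto_nhdsWithin_iff.2 ⟨tendsto_one_div_add_atTop_nhds_zero_nat,
      Eventually.of_forall fun n => (Nat.one_div_pos_of_nat (α := ℝ)).ne'⟩
  simpa [rightAverage, Function.comp_def] using h1.comp h2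

theorem continuous_of_holder {K lam : ℝ} (hl : 0 < lam) {g : ℝ → ℝ}
    (hK : ∀ x y, |g x - g y| ≤ K * |x - y| ^ lam) : Continuous g := by
  refine continuous_iff_continuousAt.2 fun x => ?_
  rw [ContinuousAt, tendsto_iff_norm_sub_tendsto_zero]
  have hz : Tendsto (fun y => K * |y - x| ^ lam) (𝓝 x) (𝓝 0) := by
    have : Continuous fun y : ℝ => K * |y - x| ^ lam :=
      continuous_const.mul ((continuous_id.sub continuous_const).abs.rpow_const fun _ => Or.inr hl.le)
    simpa [Real.zero_rpow hl.ne'] using this.tendsto x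
  exact squeeze_zero (fun _ => norm_nonneg _) (fun y => hK y x) hz

/-- Left-sided fractional integration of the right-sided fractional derivative of a Hölder function
that vanishes at the right end. -/
theorem integral_rpow_mul_weylRight {β lam K a t : ℝ} (h0 : 0 < β) (h1 : β < 1)
    (hl : 0 < lam + β - 1) (hat : a < t) {g : ℝ → ℝ}
    (hK : ∀ x y, |g x - g y| ≤ K * |x - y| ^ lam) :
    ∫ s in a..t, (s - a) ^ (-β) * weylRight (1 - β) t (fun r => g r - g t) s
      = Real.Gamma (1 - β) * (g a - g t) := by
  have hl' : 0 < lam := by linarith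
  have hg : Continuous g := continuous_of_holder hl' hK
  have hK0 : 0 ≤ K := by
    have := (abs_nonneg _).trans (hK 1 0)
    simpa using this
  have hGa := Real.Gamma_pos_of_pos h0
  set e : ℕ → ℝ := fun n => 1 / ((n : ℝ) + 1) with he
  have hepos : ∀ n, 0 < e n := fun n => Nat.one_div_pos_of_nat
  set H : ℕ → ℝ → ℝ := fun n r => rightAverage (e n) g r - rightAverage (e n) g t with hH
  have hHK : ∀ n x y, |H n x - H n y| ≤ K * |x - y| ^ lam := fun n x y => by
    simpa [hH] using abs_rightAverage_sub_le (hepos n) hg hK x y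
  have hHt : ∀ n, H n t = 0 := fun n => sub_self _
  have hHlim : ∀ s, Tendsto (fun n => H n s) atTop (𝓝 (g s - g t)) := fun s =>
    (tendsto_rightAverage hg s).sub (tendsto_rightAverage hg t)
  have hHd : ∀ n x, HasDerivAt (H n) ((e n)⁻¹ * (g (x + e n) - g x)) x := fun n x =>
    (hasDerivAt_rightAverage (e n) hg x).sub_const _
  have hHc : ∀ n, Continuous (H n) := fun n => continuous_of_holder hl' (hHK n)
  -- the identity for the mollified functions
  have hid : ∀ n, ∫ s in a..t, (s - a) ^ (-β) * weylRight (1 - β) t (H n) s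
      = Real.Gamma (1 - β) * H n a := by
    intro n
    have hc : Continuous fun x => (e n)⁻¹ * (g (x + e n) - g x) := by fun_prop
    have hFTC := intervalIntegral.integral_eq_sub_of_hasDerivAt (a := a) (b := t)
      (fun x _ => hHd n x) (hc.intervalIntegrable _ _)
    have hF := integral_rpow_mul_integral_rpow_mul h0 h1 hat hc
    rw [hFTC, hHt] at hF
    calc _ = ∫ s in a..t, -(1 / Real.Gamma β) * ((s - a) ^ (-β) *
            ∫ u in s..t, (e n)⁻¹ * (g (u + e n) - g u) * (u - s) ^ (β - 1)) := by
          rw [intervalIntegral.integral_of_le hat.le, intervalIntegral.integral_of_le hat.le,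
            integral_Ioc_eq_integral_Ioo, integral_Ioc_eq_integral_Ioo]
          refine setIntegral_congr_fun measurableSet_Ioo fun s hs => ?_
          rw [weylRight_eq_of_hasDerivAt h0 (hHd n) hc (hHt n) hs.2]
          ring
      _ = _ := by
          rw [intervalIntegral.integral_const_mul, hF]
          field_simp
          ring
  -- convergence of the derivatives
  have hw : ∀ s ∈ Ioc a t, Tendsto (fun n => weylRight (1 - β) t (H n) s) atTop
      (𝓝 (weylRight (1 - β) t (fun r => g r - g t) s)) := by
    intro s hs
    unfold weylRight
    refine (((hHlim s).div_const _).add (Tendsto.const_mul _ ?_)).const_mul _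
    refine intervalIntegral.tendsto_integral_filter_of_dominated_convergence
      (fun u => K * (u - s) ^ (lam + β - 2)) ?_ ?_ ?_ ?_
    · refine Eventually.of_forall fun n => Measurable.aestronglyMeasurable ?_
      have := (hHc n).measurable
      fun_prop
    · refine Eventually.of_forall fun n => Eventually.of_forall fun u hu => ?_
      rw [uIoc_of_le hs.2] at hu
      have hus : 0 < u - s := sub_pos.2 hu.1
      rw [Real.norm_eq_abs, show lam + β - 2 = lam - (1 - β + 1) by ring, abs_div,
        abs_of_pos (Real.rpow_pos_of_pos hus _), Real.rpow_sub hus, ← mul_div_assoc]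
      gcongr
      have := hHK n s u
      rwa [abs_sub_comm s u, abs_of_pos hus] at this
    · exact (intervalIntegrable_sub_rpow (by linarith) s s t).const_mul K
    · exact Eventually.of_forall fun u _ => ((hHlim s).sub (hHlim u)).div_const _
  -- The constant of `abs_weylRight_le`, common to all `H n`; it provides the dominating function.
  set D := 1 / Real.Gamma β * (K * (1 + (1 - β) / (lam + β - 1))) with hD
  have hD0 : 0 ≤ D := by
    have := sub_pos.2 h1
    positivity
  have hlim : Tendsto (fun n => ∫ s in a..t, (s - a) ^ (-β) * weylRight (1 - β) t (H n) s) atTop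
      (𝓝 (∫ s in a..t, (s - a) ^ (-β) * weylRight (1 - β) t (fun r => g r - g t) s)) := by
    refine intervalIntegral.tendsto_integral_filter_of_dominated_convergence
      (fun s => (s - a) ^ (-β) * (D * (t - a) ^ (lam + β - 1))) ?_ ?_ ?_ ?_
    · refine Eventually.of_forall fun n => Measurable.aestronglyMeasurable ?_
      have := measurable_weylRight (1 - β) t (hHc n).measurable
      fun_prop
    · refine Eventually.of_forall fun n => Eventually.of_forall fun s hs => ?_
      rw [uIoc_of_le hat.le] at hs
      have hsa : 0 < s - a := sub_pos.2 hs.1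
      rw [Real.norm_eq_abs, abs_mul, abs_of_pos (Real.rpow_pos_of_pos hsa _)]
      gcongr
      refine (abs_weylRight_le h0 h1 hl (hHK n) (hHt n) hs.2).trans ?_
      rw [← hD]
      have := sub_nonneg.2 hs.2
      gcongr
      exact hs.1.le
    · exact (intervalIntegrable_sub_rpow (by linarith) a a t).mul_const _
    · refine Eventually.of_forall fun s hs => (hw s ?_).const_mul _
      rwa [uIoc_of_le hat.le] at hs
  refine tendsto_nhds_unique hlim ?_
  simp only [hid]
  exact (hHlim a).const_mul _

/-! ### Linearity of the generalized Lebesgue–Stieltjes integral -/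

/-- The measurable function `f` has finite `W^β_2([0, t])` norm, the integrand of `∫_0^t f dg` is
integrable, and the integral is `I`. -/
structure HasGLSIntegral (β t : ℝ) (f g : ℝ → ℝ) (I : ℝ) : Prop where
  measurable : Measurable f
  norm_lt_top : besovNorm₂ β t f < ∞
  integrable : IntervalIntegrable (glsIntegrand β t f g) volume 0 t
  integral_eq : glsIntegral β t f g = I

theorem measurable_besov_inner {β : ℝ} {f : ℝ → ℝ} (hf : Measurable f) :
    Measurable fun s : ℝ =>
      ∫⁻ u in Ioo 0 s, ENNReal.ofReal (|f u - f s| / (s - u) ^ (1 + β)) := by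
  have : (fun s : ℝ => ∫⁻ u in Ioo 0 s, ENNReal.ofReal (|f u - f s| / (s - u) ^ (1 + β)))
      = fun s => ∫⁻ u, ({p : ℝ × ℝ | 0 < p.2 ∧ p.2 < p.1}.indicator
        (fun p => ENNReal.ofReal (|f p.2 - f p.1| / (p.1 - p.2) ^ (1 + β)))) (s, u) := by
    ext s
    rw [← lintegral_indicator measurableSet_Ioo]
    rfl
  rw [this]
  refine Measurable.lintegral_prod_right' (Measurable.indicator (by fun_prop) ?_)
  exact (measurableSet_lt measurable_const measurable_snd).inter
    (measurableSet_lt measurable_snd measurable_fst)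

/-- Makes the inner integral of `weylLeft` additive in `f`: without convergence it would take the
default value zero. -/
theorem ae_intervalIntegrable_of_besovNorm₂_lt_top {β t : ℝ} {f : ℝ → ℝ} (hf : Measurable f)
    (h : besovNorm₂ β t f < ∞) :
    ∀ᵐ s ∂volume.restrict (Ioo 0 t),
      IntervalIntegrable (fun u => (f s - f u) / (s - u) ^ (β + 1)) volume 0 s := by
  have h2 : ∫⁻ s in Ioo 0 t, ∫⁻ u in Ioo 0 s, ENNReal.ofReal (|f u - f s| / (s - u) ^ (1 + β)) < ∞ :=
    lt_of_le_of_lt le_add_self h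
  filter_upwards [ae_lt_top (measurable_besov_inner hf) h2.ne, ae_restrict_mem measurableSet_Ioo]
    with s hs hst
  rw [intervalIntegrable_iff_integrableOn_Ioo_of_le hst.1.le]
  refine ⟨Measurable.aestronglyMeasurable (by fun_prop), ?_⟩
  refine lt_of_le_of_lt (le_of_eq ?_) hs
  refine setLIntegral_congr_fun measurableSet_Ioo fun u hu => ?_
  rw [← ofReal_norm, Real.norm_eq_abs, abs_div, abs_sub_comm, add_comm β,
    abs_of_pos (Real.rpow_pos_of_pos (sub_pos.2 hu.2) _)]

theorem restrict_Ioo_eq_restrict_Ioc (a b : ℝ) :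
    (volume : Measure ℝ).restrict (Ioo a b) = volume.restrict (Ioc a b) :=
  Measure.restrict_congr_set Ioo_ae_eq_Ioc

theorem besovNorm₂_add_le {β t : ℝ} {f₁ f₂ : ℝ → ℝ} (h₁ : Measurable f₁) :
    besovNorm₂ β t (fun r => f₁ r + f₂ r) ≤ besovNorm₂ β t f₁ + besovNorm₂ β t f₂ := by
  unfold besovNorm₂
  rw [add_add_add_comm]
  refine add_le_add ?_ ?_
  · rw [← lintegral_add_left (by fun_prop)]
    refine setLIntegral_mono_ae' measurableSet_Ioo (Eventually.of_forall fun s hs => ?_)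
    have := Real.rpow_pos_of_pos hs.1 β
    rw [← ENNReal.ofReal_add (by positivity) (by positivity), ← add_div]
    gcongr
    exact abs_add_le _ _
  · rw [← lintegral_add_left (measurable_besov_inner h₁)]
    refine lintegral_mono fun s => ?_
    rw [← lintegral_add_left (by fun_prop)]
    refine setLIntegral_mono_ae' measurableSet_Ioo (Eventually.of_forall fun u hu => ?_)
    have := Real.rpow_pos_of_pos (sub_pos.2 hu.2) (1 + β)
    rw [← ENNReal.ofReal_add (by positivity) (by positivity), ← add_div]
    gcongr
    calc |f₁ u + f₂ u - (f₁ s + f₂ s)| = |(f₁ u - f₁ s) + (f₂ u - f₂ s)| := by ring_nf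
      _ ≤ _ := abs_add_le _ _

theorem HasGLSIntegral.add {β t : ℝ} {f₁ f₂ g : ℝ → ℝ} {I₁ I₂ : ℝ} (ht : 0 ≤ t)
    (h₁ : HasGLSIntegral β t f₁ g I₁) (h₂ : HasGLSIntegral β t f₂ g I₂) :
    HasGLSIntegral β t (fun r => f₁ r + f₂ r) g (I₁ + I₂) := by
  have hae : ∀ᵐ s ∂volume.restrict (Ioc 0 t), glsIntegrand β t f₁ g s + glsIntegrand β t f₂ g s
      = glsIntegrand β t (fun r => f₁ r + f₂ r) g s := by
    rw [← restrict_Ioo_eq_restrict_Ioc]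
    filter_upwards [ae_intervalIntegrable_of_besovNorm₂_lt_top h₁.measurable h₁.norm_lt_top,
      ae_intervalIntegrable_of_besovNorm₂_lt_top h₂.measurable h₂.norm_lt_top] with s i₁ i₂
    unfold glsIntegrand
    rw [← add_mul]
    congr 1
    unfold weylLeft
    have : ∀ u, (f₁ s + f₂ s - (f₁ u + f₂ u)) / (s - u) ^ (β + 1)
        = (f₁ s - f₁ u) / (s - u) ^ (β + 1) + (f₂ s - f₂ u) / (s - u) ^ (β + 1) := fun u => by ring
    simp only [this]
    rw [intervalIntegral.integral_add i₁ i₂]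
    ring
  refine ⟨h₁.measurable.add h₂.measurable,
    (besovNorm₂_add_le h₁.measurable).trans_lt (ENNReal.add_lt_top.2 ⟨h₁.norm_lt_top, h₂.norm_lt_top⟩),
    ?_, ?_⟩
  · refine (h₁.integrable.add h₂.integrable).congr_ae ?_
    rwa [uIoc_of_le ht]
  · rw [← h₁.integral_eq, ← h₂.integral_eq]
    unfold glsIntegral
    rw [← neg_add, ← intervalIntegral.integral_add h₁.integrable h₂.integrable]
    congr 1
    rw [intervalIntegral.integral_of_le ht, intervalIntegral.integral_of_le ht]
    exact (integral_congr_ae hae).symm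

theorem HasGLSIntegral.const_mul {β t : ℝ} {f g : ℝ → ℝ} {I : ℝ} (c : ℝ)
    (h : HasGLSIntegral β t f g I) : HasGLSIntegral β t (fun r => c * f r) g (c * I) := by
  have hw : ∀ s, glsIntegrand β t (fun r => c * f r) g s = c * glsIntegrand β t f g s := by
    intro s
    unfold glsIntegrand weylLeft
    have : ∀ u, (c * f s - c * f u) / (s - u) ^ (β + 1) = c * ((f s - f u) / (s - u) ^ (β + 1)) :=
      fun u => by ring
    simp only [this, intervalIntegral.integral_const_mul]
    ring
  refine ⟨h.measurable.const_mul c, ?_, ?_, ?_⟩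
  · refine lt_of_le_of_lt (le_of_eq ?_) (ENNReal.mul_lt_top (ENNReal.ofReal_lt_top (r := |c|))
      h.norm_lt_top)
    unfold besovNorm₂
    have hfm := h.measurable
    rw [mul_add, ← lintegral_const_mul _ (by fun_prop),
      ← lintegral_const_mul _ (measurable_besov_inner hfm)]
    congr 1
    · refine lintegral_congr fun s => ?_
      rw [← ENNReal.ofReal_mul (abs_nonneg c), abs_mul, mul_div_assoc]
    · refine lintegral_congr fun s => ?_
      rw [← lintegral_const_mul _ (by fun_prop)]
      refine lintegral_congr fun u => ?_
      rw [← ENNReal.ofReal_mul (abs_nonneg c), ← mul_sub, abs_mul, mul_div_assoc]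
  · rw [funext hw]
    exact h.integrable.const_mul c
  · rw [glsIntegral, funext hw, intervalIntegral.integral_const_mul, ← mul_neg, ← glsIntegral,
      h.integral_eq]

theorem HasGLSIntegral.zero (β t : ℝ) (g : ℝ → ℝ) : HasGLSIntegral β t (fun _ => 0) g 0 := by
  have : glsIntegrand β t (fun _ => 0) g = fun _ => 0 := by
    ext s
    simp [glsIntegrand, weylLeft]
  refine ⟨measurable_const, by simp [besovNorm₂], ?_, ?_⟩
  · rw [this]
    exact intervalIntegrable_const
  · simp [glsIntegral, this]

theorem HasGLSIntegral.sum {ι : Type*} {β t : ℝ} {g : ℝ → ℝ} (ht : 0 ≤ t) (S : Finset ι)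
    {f : ι → ℝ → ℝ} {I : ι → ℝ} (h : ∀ i ∈ S, HasGLSIntegral β t (f i) g (I i)) :
    HasGLSIntegral β t (fun r => ∑ i ∈ S, f i r) g (∑ i ∈ S, I i) := by
  classical
  induction S using Finset.induction_on with
  | empty => simpa using HasGLSIntegral.zero β t g
  | insert a S ha ih =>
    simp only [Finset.sum_insert ha]
    exact (h a (Finset.mem_insert_self a S)).add ht
      (ih fun i hi => h i (Finset.mem_insert_of_mem hi))

/-! ### Step functions -/

theorem integral_left_kernel {β : ℝ} (h0 : 0 < β) {p s : ℝ} (hps : p < s) (hp : 0 ≤ p) :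
    ∫ u in (0 : ℝ)..p, (s - u) ^ (-(β + 1)) = ((s - p) ^ (-β) - s ^ (-β)) / β := by
  rw [intervalIntegral.integral_comp_sub_left (fun x => x ^ (-(β + 1))), integral_rpow]
  · rw [sub_zero, show -(β + 1) + 1 = -β by ring, div_neg, ← neg_div, neg_sub]
  · refine Or.inr ⟨by linarith, fun h => ?_⟩
    rw [sub_zero, uIcc_of_le (by linarith)] at h
    linarith [h.1]

theorem intervalIntegrable_left_kernel {β : ℝ} {p s : ℝ} (hps : p < s) (hp : 0 ≤ p) :
    IntervalIntegrable (fun u => (s - u) ^ (-(β + 1))) volume 0 p := by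
  refine ContinuousOn.intervalIntegrable fun u hu => ContinuousAt.continuousWithinAt ?_
  rw [uIcc_of_le hp] at hu
  exact ContinuousAt.rpow_const (by fun_prop) (Or.inl (by linarith [hu.2]))

theorem weylLeft_indicator_of_lt {β p s : ℝ} (hs : 0 < s) (h : s < p) :
    weylLeft β ((Ici p).indicator fun _ => 1) s = 0 := by
  have h1 : (Ici p).indicator (fun _ => (1 : ℝ)) s = 0 := indicator_of_notMem (by simpa using h) _
  have h2 : ∫ u in (0 : ℝ)..s, ((Ici p).indicator (fun _ => (1 : ℝ)) s
      - (Ici p).indicator (fun _ => (1 : ℝ)) u) / (s - u) ^ (β + 1) = 0 := by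
    rw [intervalIntegral.integral_congr (g := fun _ => 0), intervalIntegral.integral_zero]
    intro u hu
    rw [uIcc_of_le hs.le] at hu
    have : (Ici p).indicator (fun _ => (1 : ℝ)) u = 0 :=
      indicator_of_notMem (by simpa using hu.2.trans_lt h) _
    simp [h1, this]
  rw [weylLeft, h2, h1]
  simp

theorem Ioc_inter_Iio_of_le {p s : ℝ} (h : p ≤ s) : Ioc 0 s ∩ Iio p = Ioo 0 p := by
  ext u
  simp only [mem_inter_iff, mem_Ioc, mem_Iio, mem_Ioo]
  exact ⟨fun h => ⟨h.1.1, h.2⟩, fun h' => ⟨⟨h'.1, h'.2.le.trans h⟩, h'.2⟩⟩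

/-- Only `u < p` contributes to the inner integral, and the resulting `-s ^ (-β)` cancels the
non-integral term. -/
theorem weylLeft_indicator_of_gt {β p s : ℝ} (h0 : 0 < β) (hp : 0 ≤ p) (h : p < s) :
    weylLeft β ((Ici p).indicator fun _ => 1) s = 1 / Real.Gamma (1 - β) * (s - p) ^ (-β) := by
  have hs : 0 < s := hp.trans_lt h
  have h1 : (Ici p).indicator (fun _ => (1 : ℝ)) s = 1 := indicator_of_mem (mem_Ici.2 h.le) _
  have h2 : ∫ u in (0 : ℝ)..s, ((Ici p).indicator (fun _ => (1 : ℝ)) s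
      - (Ici p).indicator (fun _ => (1 : ℝ)) u) / (s - u) ^ (β + 1)
      = ((s - p) ^ (-β) - s ^ (-β)) / β := by
    rw [← integral_left_kernel h0 h hp, intervalIntegral.integral_of_le hs.le,
      intervalIntegral.integral_of_le hp, integral_Ioc_eq_integral_Ioo (y := p),
      ← Ioc_inter_Iio_of_le h.le, inter_comm, ← Measure.restrict_restrict measurableSet_Iio,
      ← integral_indicator measurableSet_Iio]
    refine setIntegral_congr_fun measurableSet_Ioc fun u hu => ?_
    rw [h1]
    by_cases hup : u < p
    · simp [indicator, hup, hup.not_ge, -neg_add_rev, Real.rpow_neg (sub_nonneg.2 hu.2)]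
    · simp [indicator, hup, not_lt.1 hup]
  rw [weylLeft, h2, h1, Real.rpow_neg hs.le]
  field_simp
  ring

theorem besovNorm₂_indicator_lt_top {β p t : ℝ} (h0 : 0 < β) (h1 : β < 1) (hp : 0 ≤ p) :
    besovNorm₂ β t ((Ici p).indicator fun _ => 1) < ∞ := by
  -- One bound for both parts of the norm: the inner integral of the second is at most `(s - p) ^
  -- (-β) / β`, while for the first, with `c = 0`, the factor `1 / β > 1` is slack.
  have hI : ∀ c, ∫⁻ s in Ioo 0 t, ENNReal.ofReal ‖(s - c) ^ (-β) / β‖ < ∞ := by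
    intro c
    have := ((intervalIntegrable_sub_rpow (r := -β) (by linarith) c 0 t).div_const β).1
    have := (this.mono_set Ioo_subset_Ioc_self).2
    simpa only [HasFiniteIntegral, ← ofReal_norm] using this
  refine ENNReal.add_lt_top.2 ⟨lt_of_le_of_lt ?_ (hI 0), lt_of_le_of_lt ?_ (hI p)⟩
  · refine setLIntegral_mono_ae' measurableSet_Ioo (Eventually.of_forall fun s hs => ?_)
    refine ENNReal.ofReal_le_ofReal ?_
    have hpos := Real.rpow_pos_of_pos hs.1 (-β)
    rw [sub_zero, Real.norm_of_nonneg (by positivity), le_div_iff₀ h0, div_eq_mul_inv,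
      ← Real.rpow_neg hs.1.le]
    have : |(Ici p).indicator (fun _ => (1 : ℝ)) s| ≤ 1 := by
      by_cases h : p ≤ s <;> simp [indicator, h]
    nlinarith [mul_le_one₀ this h0.le h1.le]
  · have hne : ∀ᵐ s ∂(volume : Measure ℝ), s ≠ p := Measure.ae_ne volume p
    refine setLIntegral_mono_ae' measurableSet_Ioo (hne.mono fun s hsp hs => ?_)
    rcases lt_or_gt_of_ne hsp with h | h
    · refine le_of_eq_of_le ?_ zero_le
      rw [setLIntegral_congr_fun (g := fun _ => 0) measurableSet_Ioo, lintegral_zero]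
      intro u hu
      simp [indicator, (hu.2.trans h).not_ge, h.not_ge]
    · have hsp : 0 < s - p := sub_pos.2 h
      calc _ = ∫⁻ u in Ioo 0 p, ENNReal.ofReal ((s - u) ^ (-(β + 1))) := by
            have : Ioo 0 p = Iio p ∩ Ioo 0 s := by
              ext u
              simp only [mem_inter_iff, mem_Iio, mem_Ioo]
              exact ⟨fun h' => ⟨h'.2, h'.1, h'.2.trans h⟩, fun h' => ⟨h'.2.1, h'.1⟩⟩
            rw [this, ← Measure.restrict_restrict measurableSet_Iio,
              ← lintegral_indicator measurableSet_Iio]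
            refine setLIntegral_congr_fun measurableSet_Ioo fun u hu => ?_
            by_cases hup : u < p
            · simp [indicator, hup, hup.not_ge, h.le, -neg_add_rev, Real.rpow_neg (sub_nonneg.2 hu.2.le),
                add_comm]
            · simp [indicator, hup, not_lt.1 hup, h.le]
        _ = ENNReal.ofReal (((s - p) ^ (-β) - s ^ (-β)) / β) := by
            rw [← integral_left_kernel h0 h hp, intervalIntegral.integral_of_le hp,
              integral_Ioc_eq_integral_Ioo, ofReal_integral_eq_lintegral_ofReal]
            · exact (intervalIntegrable_left_kernel h hp).1.mono_set Ioo_subset_Ioc_self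
            · exact (ae_restrict_mem measurableSet_Ioo).mono fun u hu =>
                Real.rpow_nonneg (by linarith [hu.2]) _
        _ ≤ _ := by
            refine ENNReal.ofReal_le_ofReal (le_trans ?_ (le_abs_self _))
            gcongr
            linarith [Real.rpow_nonneg hs.1.le (-β)]

theorem weylRight_congr {β t : ℝ} {h k : ℝ → ℝ} {s : ℝ} (hst : s ≤ t)
    (hk : EqOn h k (Icc s t)) : weylRight β t h s = weylRight β t k s := by
  unfold weylRight
  rw [hk ⟨le_rfl, hst⟩]
  congr 3
  refine intervalIntegral.integral_congr fun u hu => ?_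
  rw [uIcc_of_le hst] at hu
  simp only [hk hu]

/-- The left derivative vanishes before `p`, so only `g` on `[p, t]` matters, and there it may be
replaced by the globally Hölder `G`. The minimum also covers `t ≤ p`, where the integral is zero. -/
theorem hasGLSIntegral_indicator_Ici {β lam K A p t : ℝ} (h0 : 0 < β) (h1 : β < 1)
    (hl : 0 < lam + β - 1) (hA : 0 ≤ A) (hAp : A ≤ p) (ht : 0 ≤ t) {g G : ℝ → ℝ}
    (hK : ∀ x y, |G x - G y| ≤ K * |x - y| ^ lam) (hG : EqOn g G (Icc A t)) :
    HasGLSIntegral β t ((Ici p).indicator fun _ => 1) g (g t - g (min p t)) := by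
  have hp : 0 ≤ p := hA.trans hAp
  have hne : ∀ᵐ s ∂(volume : Measure ℝ), s ≠ p := Measure.ae_ne volume p
  have hmeas : Measurable ((Ici p).indicator fun _ => (1 : ℝ)) :=
    measurable_const.indicator measurableSet_Ici
  suffices h : IntervalIntegrable (glsIntegrand β t ((Ici p).indicator fun _ => 1) g) volume 0 t ∧
      glsIntegral β t ((Ici p).indicator fun _ => 1) g = g t - g (min p t) from
    ⟨hmeas, besovNorm₂_indicator_lt_top h0 h1 hp, h.1, h.2⟩
  rcases le_or_gt t p with htp | hpt
  · have hae : ∀ᵐ s ∂volume.restrict (Ioc 0 t), (0 : ℝ)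
        = glsIntegrand β t ((Ici p).indicator fun _ => 1) g s := by
      filter_upwards [ae_restrict_mem measurableSet_Ioc, ae_restrict_of_ae hne] with s hs hsp
      rw [glsIntegrand, weylLeft_indicator_of_lt hs.1 (lt_of_le_of_ne (hs.2.trans htp) hsp),
        zero_mul]
    constructor
    · exact (intervalIntegrable_const (c := (0 : ℝ))).congr_ae (by rwa [uIoc_of_le ht])
    · rw [glsIntegral, intervalIntegral.integral_of_le ht, ← integral_congr_ae hae, min_eq_right htp]
      simp
  · have hl' : 0 < lam := by linarith
    have hGc : Continuous G := continuous_of_holder hl' hK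
    set R : ℝ → ℝ := weylRight (1 - β) t (fun r => G r - G t)
    have hae : ∀ᵐ s ∂volume.restrict (Ioc 0 t),
        (Ioi p).indicator (fun s => 1 / Real.Gamma (1 - β) * ((s - p) ^ (-β) * R s)) s
        = glsIntegrand β t ((Ici p).indicator fun _ => 1) g s := by
      filter_upwards [ae_restrict_mem measurableSet_Ioc, ae_restrict_of_ae hne] with s hs hsp
      rw [glsIntegrand]
      rcases lt_or_gt_of_ne hsp with h | h
      · rw [weylLeft_indicator_of_lt hs.1 h, zero_mul, indicator_of_notMem (by simpa using h.le)]
      · rw [weylLeft_indicator_of_gt h0 hp h, indicator_of_mem (mem_Ioi.2 h), mul_assoc]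
        congr 2
        refine weylRight_congr hs.2 fun u hu => ?_
        rw [hG ⟨hAp.trans (h.le.trans hu.1), hu.2⟩, hG ⟨hAp.trans hpt.le, le_rfl⟩]
    have hset : Ioi p ∩ Ioc 0 t = Ioc p t := by
      rw [inter_comm, Ioc_inter_Ioi, max_eq_right hp]
    have hRi : IntegrableOn (fun s => (s - p) ^ (-β) * R s) (Ioc p t) := by
      set D := 1 / Real.Gamma β * (K * (1 + (1 - β) / (lam + β - 1)))
      have hK0 : 0 ≤ K := by simpa using (abs_nonneg _).trans (hK 1 0)
      have hD0 : 0 ≤ D := by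
        have := sub_pos.2 h1
        have := Real.Gamma_pos_of_pos h0
        positivity
      refine Integrable.mono' ((intervalIntegrable_sub_rpow (r := -β) (by linarith) p p t).mul_const
        (D * (t - p) ^ (lam + β - 1))).1 ?_ ?_
      · refine Measurable.aestronglyMeasurable ?_
        have : Measurable R := measurable_weylRight _ _ (by fun_prop)
        fun_prop
      · refine (ae_restrict_mem measurableSet_Ioc).mono fun s hs => ?_
        have hsa : 0 < s - p := sub_pos.2 hs.1
        rw [Real.norm_eq_abs, abs_mul, abs_of_pos (Real.rpow_pos_of_pos hsa _)]
        gcongr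
        refine (abs_weylRight_le (h := fun r => G r - G t) h0 h1 hl (fun x y => by simpa using hK x y)
          (sub_self _) hs.2).trans ?_
        have := sub_nonneg.2 hs.2
        gcongr
        exact hs.1.le
    constructor
    · refine IntervalIntegrable.congr_ae (f := (Ioi p).indicator
        (fun s => 1 / Real.Gamma (1 - β) * ((s - p) ^ (-β) * R s))) ?_ (by rwa [uIoc_of_le ht])
      rw [intervalIntegrable_iff_integrableOn_Ioc_of_le ht, IntegrableOn,
        integrable_indicator_iff measurableSet_Ioi, IntegrableOn,
        Measure.restrict_restrict measurableSet_Ioi, hset]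
      exact hRi.const_mul _
    · have hid := integral_rpow_mul_weylRight h0 h1 hl hpt hK
      rw [intervalIntegral.integral_of_le hpt.le] at hid
      rw [glsIntegral, intervalIntegral.integral_of_le ht, ← integral_congr_ae hae,
        integral_indicator measurableSet_Ioi, Measure.restrict_restrict measurableSet_Ioi, hset,
        integral_const_mul, hid, min_eq_left hpt.le, hG ⟨hAp.trans hpt.le, le_rfl⟩,
        hG ⟨hAp, hpt.le⟩]
      have := (Real.Gamma_pos_of_pos (sub_pos.2 h1)).ne'
      field_simp
      ring

theorem hasGLSIntegral_indicator_Ico {β lam K A p q t : ℝ} (h0 : 0 < β) (h1 : β < 1)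
    (hl : 0 < lam + β - 1) (hA : 0 ≤ A) (hAp : A ≤ p) (hpq : p ≤ q) (ht : 0 ≤ t) {g G : ℝ → ℝ}
    (hK : ∀ x y, |G x - G y| ≤ K * |x - y| ^ lam) (hG : EqOn g G (Icc A t)) :
    HasGLSIntegral β t ((Ico p q).indicator fun _ => 1) g (g (min q t) - g (min p t)) := by
  have hP := hasGLSIntegral_indicator_Ici h0 h1 hl hA hAp ht hK hG
  have hQ := hasGLSIntegral_indicator_Ici h0 h1 hl hA (hAp.trans hpq) ht hK hG
  convert! hP.add ht (hQ.const_mul (-1)) using 1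
  · ext r
    by_cases h : p ≤ r
    · by_cases h' : q ≤ r
      · simp [indicator, h, h', h'.not_gt]
      · simp [indicator, h, h', not_le.1 h']
    · have h' : ¬ q ≤ r := fun h' => h (hpq.trans h')
      simp [indicator, h, h']
  · ring

/-! ### Hölder integrators, and replacing an integrand by one that agrees on `[0, t]`. -/

theorem besovNorm₁_lt_top {β lam K a t : ℝ} (h1 : β < 1) (hl : 0 < lam + β - 1)
    {g : ℝ → ℝ} (hK0 : 0 ≤ K)
    (hK : ∀ x ∈ Icc a t, ∀ y ∈ Icc a t, |g x - g y| ≤ K * |x - y| ^ lam) :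
    besovNorm₁ (1 - β) a t g < ∞ := by
  have hl' : 0 < lam := by linarith
  refine lt_of_le_of_lt (b := ENNReal.ofReal (K * (t - a) ^ (lam + β - 1))
    + ENNReal.ofReal (K * ((t - a) ^ (lam + β - 1) / (lam + β - 1)))) ?_
    (ENNReal.add_lt_top.2 ⟨ENNReal.ofReal_lt_top, ENNReal.ofReal_lt_top⟩)
  refine iSup_le fun s => iSup_le fun r => iSup_le fun has => iSup_le fun hsr => iSup_le fun hrt => ?_
  have hrs : 0 < r - s := sub_pos.2 hsr
  have hle : (r - s) ^ (lam + β - 1) ≤ (t - a) ^ (lam + β - 1) := by gcongr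
  refine add_le_add (ENNReal.ofReal_le_ofReal ?_) ?_
  · have := abs_div_rpow_le (K := K) (lam := lam) (r := 1 - β) (x := g r - g s) hrs.le hl'
      (by linarith [hl]) (by
        have := hK r ⟨has.trans hsr.le, hrt⟩ s ⟨has, hsr.le.trans hrt⟩
        rwa [abs_of_pos hrs] at this)
    rw [abs_div, abs_of_pos (Real.rpow_pos_of_pos hrs _)] at this
    refine this.trans ?_
    rw [show lam - (1 - β) = lam + β - 1 by ring]
    gcongr
  · have hint := (intervalIntegrable_sub_rpow (r := lam + β - 2) (by linarith) s s r).const_mul K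
    calc _ ≤ ∫⁻ u in Ioo s r, ENNReal.ofReal (K * (u - s) ^ (lam + β - 2)) := by
          refine setLIntegral_mono_ae' measurableSet_Ioo (Eventually.of_forall fun u hu => ?_)
          refine ENNReal.ofReal_le_ofReal ?_
          have hus : 0 < u - s := sub_pos.2 hu.1
          rw [show lam + β - 2 = lam - (1 + (1 - β)) by ring, Real.rpow_sub hus, ← mul_div_assoc]
          gcongr
          have := hK u ⟨has.trans hu.1.le, hu.2.le.trans hrt⟩ s ⟨has, hsr.le.trans hrt⟩
          rwa [abs_of_pos hus] at this
      _ = ENNReal.ofReal (K * ((r - s) ^ (lam + β - 1) / (lam + β - 1))) := by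
          rw [← ofReal_integral_eq_lintegral_ofReal]
          · rw [← integral_Ioc_eq_integral_Ioo, ← intervalIntegral.integral_of_le hsr.le,
              intervalIntegral.integral_const_mul, integral_sub_rpow (by linarith),
              show lam + β - 2 + 1 = lam + β - 1 by ring]
          · exact hint.1.mono_set Ioo_subset_Ioc_self
          · exact (ae_restrict_mem measurableSet_Ioo).mono fun u hu =>
              mul_nonneg hK0 (Real.rpow_nonneg (sub_pos.2 hu.1).le _)
      _ ≤ _ := by gcongr

theorem weylLeft_congr {β : ℝ} {f k : ℝ → ℝ} {s : ℝ} (hs : 0 ≤ s) (hk : EqOn f k (Icc 0 s)) :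
    weylLeft β f s = weylLeft β k s := by
  unfold weylLeft
  rw [hk ⟨hs, le_rfl⟩]
  congr 3
  refine intervalIntegral.integral_congr fun u hu => ?_
  rw [uIcc_of_le hs] at hu
  simp only [hk hu]

/-- Passes from finite sums of blocks to the strategy, which agrees with such a sum on each `[0, s]`
with `s < T`. -/
theorem HasGLSIntegral.glsIntegral_eq {β t I : ℝ} {f k g : ℝ → ℝ} (ht : 0 ≤ t)
    (h : HasGLSIntegral β t f g I) (hk : EqOn k f (Icc 0 t)) : glsIntegral β t k g = I := by
  rw [← h.integral_eq, glsIntegral, glsIntegral]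
  congr 1
  refine intervalIntegral.integral_congr fun s hs => ?_
  rw [uIcc_of_le ht] at hs
  simp only [glsIntegrand]
  rw [weylLeft_congr hs.1 (hk.mono (Icc_subset_Icc_right hs.2))]

theorem HasGLSIntegral.glsIntegrable {β t I a : ℝ} {f k g : ℝ → ℝ} (hβ : β ∈ Ioo (0 : ℝ) 1)
    (h : HasGLSIntegral β t f g I) (hk : EqOn k f (Icc 0 t))
    (hg : ContinuousOn g (Icc 0 t)) (ha : a ∈ Icc 0 t) (hk0 : ∀ s ∈ Ico 0 a, k s = 0)
    (hgn : besovNorm₁ (1 - β) a t g < ∞) : GLSIntegrable β t k g := by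
  have ht : 0 ≤ t := ha.1.trans ha.2
  refine ⟨hβ, ⟨?_, ?_⟩, hg, ⟨a, ha, hk0, ?_, hgn⟩, ?_⟩
  · refine h.measurable.aemeasurable.congr ?_
    exact (ae_restrict_mem measurableSet_Icc).mono fun s hs => (hk hs).symm
  · refine lt_of_le_of_lt (le_of_eq ?_) h.norm_lt_top
    unfold besovNorm₂
    congr 1
    · refine setLIntegral_congr_fun measurableSet_Ioo fun s hs => ?_
      simp only [hk (Ioo_subset_Icc_self hs)]
    · refine setLIntegral_congr_fun measurableSet_Ioo fun s hs => ?_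
      refine setLIntegral_congr_fun measurableSet_Ioo fun u hu => ?_
      simp only [hk (Ioo_subset_Icc_self hs), hk ⟨hu.1.le, (hu.2.trans hs.2).le⟩]
  · exact (hg.mono (Icc_subset_Icc_left ha.1)).aemeasurable measurableSet_Icc
  · refine h.integrable.congr_ae ?_
    rw [uIoc_of_le ht]
    refine (ae_restrict_mem measurableSet_Ioc).mono fun s hs => ?_
    simp only [glsIntegrand]
    rw [weylLeft_congr hs.1.le (hk.mono (Icc_subset_Icc_right hs.2))]

/-! ### Hölder continuity from dyadic increments -/

/-- Chaining: `f x` is the limit of `f` along the dyadic floors `d x n`, whose successive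
differences decay geometrically. Two points at distance about `2^{-n}` have equal or adjacent floors
at level `n`. -/
theorem holder_of_dyadic {f : ℝ → ℝ} {K γ : ℝ} (hf : ContinuousOn f (Icc 0 1)) (hγ : 0 < γ)
    (hK0 : 0 ≤ K) (hK : ∀ n k : ℕ, k + 1 ≤ 2 ^ n →
      |f (((k + 1 : ℕ) : ℝ) / 2 ^ n) - f ((k : ℝ) / 2 ^ n)| ≤ K * ((1 / 2 : ℝ) ^ γ) ^ n) :
    ∃ C, 0 ≤ C ∧ ∀ x ∈ Icc (0 : ℝ) 1, ∀ y ∈ Icc (0 : ℝ) 1, |f x - f y| ≤ C * |x - y| ^ γ := by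
  set r : ℝ := (1 / 2 : ℝ) ^ γ with hr
  have hr0 : 0 < r := by positivity
  have hr1 : r < 1 := Real.rpow_lt_one (by norm_num) (by norm_num) hγ
  let d : ℝ → ℕ → ℝ := fun x n => (⌊x * 2 ^ n⌋₊ : ℝ) / 2 ^ n
  have hdx : ∀ x ∈ Icc (0 : ℝ) 1, ∀ n, d x n ≤ x := fun x hx n => by
    rw [div_le_iff₀ (by positivity)]
    exact Nat.floor_le (mul_nonneg hx.1 (by positivity))
  have hfl : ∀ x ∈ Icc (0 : ℝ) 1, ∀ n, ⌊x * 2 ^ n⌋₊ ≤ 2 ^ n := fun x hx n => by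
    refine Nat.floor_le_of_le ?_
    push_cast
    nlinarith [hx.2, show (0 : ℝ) < 2 ^ n by positivity]
  have hlim : ∀ x ∈ Icc (0 : ℝ) 1, Tendsto (fun n => f (d x n)) atTop (𝓝 (f x)) := by
    intro x hx
    refine (hf x hx).tendsto.comp (tendsto_nhdsWithin_iff.2 ⟨?_, ?_⟩)
    · exact (tendsto_nat_floor_mul_div_atTop hx.1).comp
        (tendsto_pow_atTop_atTop_of_one_lt one_lt_two)
    · exact Eventually.of_forall fun n => ⟨by positivity, (hdx x hx n).trans hx.2⟩
  have hstep : ∀ x ∈ Icc (0 : ℝ) 1, ∀ n, dist (f (d x n)) (f (d x (n + 1))) ≤ K * r * r ^ n := by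
    intro x hx n
    have hx0 : 0 ≤ x * 2 ^ n := mul_nonneg hx.1 (by positivity)
    set j := ⌊x * 2 ^ n⌋₊ with hj
    have h1 : (j : ℝ) ≤ x * 2 ^ n := Nat.floor_le hx0
    have h2 : x * 2 ^ n < j + 1 := Nat.lt_floor_add_one _
    have e : x * 2 ^ (n + 1) = 2 * (x * 2 ^ n) := by ring
    -- The next floor is `2 * j` or `2 * j + 1`, so each refinement costs at most one dyadic
    -- increment.
    have h3 : 2 * j ≤ ⌊x * 2 ^ (n + 1)⌋₊ := Nat.le_floor (by push_cast; linarith)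
    have h4 : ⌊x * 2 ^ (n + 1)⌋₊ < 2 * j + 2 :=
      (Nat.floor_lt (by rw [e]; positivity)).2 (by push_cast; linarith)
    have h5 : d x n = ((2 * j : ℕ) : ℝ) / 2 ^ (n + 1) := by
      simp only [d, ← hj]
      push_cast
      rw [pow_succ]
      field_simp
    rcases (show ⌊x * 2 ^ (n + 1)⌋₊ = 2 * j ∨ ⌊x * 2 ^ (n + 1)⌋₊ = 2 * j + 1 by omega) with h | h
    · rw [h5]
      simp only [d, h, dist_self]
      positivity
    · have := hK (n + 1) (2 * j) (h ▸ hfl x hx (n + 1))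
      rw [dist_comm, Real.dist_eq, h5]
      simp only [d, h]
      rwa [pow_succ r, mul_comm (r ^ n), ← mul_assoc] at this
  have hdist : ∀ x ∈ Icc (0 : ℝ) 1, ∀ n, |f (d x n) - f x| ≤ K * r * r ^ n / (1 - r) :=
    fun x hx n => dist_le_of_le_geometric_of_tendsto r (K * r) hr1 (hstep x hx) (hlim x hx) n
  have hmain : ∀ x ∈ Icc (0 : ℝ) 1, ∀ y ∈ Icc (0 : ℝ) 1, x < y →
      |f x - f y| ≤ (2 * (K * r / (1 - r)) + K) * r⁻¹ * |x - y| ^ γ := by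
    intro x hx y hy hxy
    -- The level at which `(1/2)^(n+1) < y - x ≤ (1/2)^n`.
    obtain ⟨n, hn1, hn2⟩ := exists_nat_pow_near_of_lt_one (sub_pos.2 hxy)
      (by linarith [hx.1, hy.2]) (show (0 : ℝ) < 1 / 2 by norm_num) (by norm_num)
    have h2n : (0 : ℝ) < 2 ^ n := by positivity
    have hxy2 : y * 2 ^ n ≤ x * 2 ^ n + 1 := by
      have : (y - x) * 2 ^ n ≤ (1 / 2) ^ n * 2 ^ n := by gcongr
      rw [← mul_pow] at this
      norm_num at this
      linarith
    have hij : ⌊x * 2 ^ n⌋₊ ≤ ⌊y * 2 ^ n⌋₊ := by gcongr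
    have hji : ⌊y * 2 ^ n⌋₊ < ⌊x * 2 ^ n⌋₊ + 2 := by
      refine (Nat.floor_lt (mul_nonneg hy.1 h2n.le)).2 ?_
      push_cast
      linarith [Nat.lt_floor_add_one (x * 2 ^ n)]
    have hmid : |f (d x n) - f (d y n)| ≤ K * r ^ n := by
      rcases (show ⌊y * 2 ^ n⌋₊ = ⌊x * 2 ^ n⌋₊ ∨ ⌊y * 2 ^ n⌋₊ = ⌊x * 2 ^ n⌋₊ + 1 by omega)
        with h | h
      · simp only [d, h, sub_self, abs_zero]
        positivity
      · rw [abs_sub_comm]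
        simp only [d, h]
        exact hK n _ (h ▸ hfl y hy n)
    have hrn : r ^ n ≤ r⁻¹ * |x - y| ^ γ := by
      rw [le_inv_mul_iff₀ hr0, mul_comm, ← pow_succ, hr, Real.rpow_pow_comm (by norm_num),
        abs_sub_comm, abs_of_pos (sub_pos.2 hxy)]
      gcongr
    have hxd := hdist x hx n
    have hyd := hdist y hy n
    calc |f x - f y| = |-(f (d x n) - f x) + (f (d x n) - f (d y n)) + (f (d y n) - f y)| := by
          ring_nf
      _ ≤ |f (d x n) - f x| + |f (d x n) - f (d y n)| + |f (d y n) - f y| := by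
          refine (abs_add_le _ _).trans (add_le_add_left ((abs_add_le _ _).trans ?_) _)
          rw [abs_neg]
      _ ≤ (2 * (K * r / (1 - r)) + K) * r ^ n := by
          have : K * r * r ^ n / (1 - r) = K * r / (1 - r) * r ^ n := by ring
          rw [this] at hxd hyd
          linarith
      _ ≤ _ := by
          have := sub_pos.2 hr1
          rw [mul_assoc]
          gcongr
  have := sub_pos.2 hr1
  refine ⟨(2 * (K * r / (1 - r)) + K) * r⁻¹, by positivity, fun x hx y hy => ?_⟩
  rcases lt_trichotomy x y with h | rfl | h
  · exact hmain x hx y hy h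
  · simp [Real.zero_rpow hγ.ne']
  · rw [abs_sub_comm, abs_sub_comm x]
    exact hmain y hy x hx h

/-- Compose with the projection onto `[A, T]`, which is 1-Lipschitz. -/
theorem exists_holder_extension {g : ℝ → ℝ} {A T K γ : ℝ} (hAT : A ≤ T) (hγ : 0 < γ) (hK0 : 0 ≤ K)
    (hK : ∀ x ∈ Icc A T, ∀ y ∈ Icc A T, |g x - g y| ≤ K * |x - y| ^ γ) :
    ∃ G : ℝ → ℝ, (∀ x y, |G x - G y| ≤ K * |x - y| ^ γ) ∧ EqOn g G (Icc A T) := by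
  refine ⟨fun x => g (projIcc A T hAT x), fun x y => ?_, fun x hx => ?_⟩
  · refine (hK _ (projIcc A T hAT x).2 _ (projIcc A T hAT y).2).trans ?_
    exact mul_le_mul_of_nonneg_left
      (Real.rpow_le_rpow (abs_nonneg _) (abs_projIcc_sub_projIcc hAT) hγ.le) hK0
  · simp [projIcc_of_mem hAT hx]

variable {Ω : Type*} {mΩ : MeasurableSpace Ω}

/-! ### Path regularity from moments of the increments -/

/-- Kolmogorov's criterion. The `p`-th powers of all dyadic increments, weighted by `r ^ (-n p)`,
have a summable expectation, so almost surely their sum `S` is finite and bounds every increment.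
Paths are already continuous, so no modification is needed. -/
theorem ae_holder_of_moments {P : Measure Ω} {X : ℝ → Ω → ℝ} {A δ γ q M : ℝ} {p : ℕ} (hδ : 0 < δ)
    (hγ : 0 < γ) (hp : p ≠ 0) (hq : 1 + γ * p < q)
    (hmeas : ∀ t ∈ Icc A (A + δ), AEMeasurable (X t) P)
    (hcont : ∀ ω, ContinuousOn (fun t => X t ω) (Icc A (A + δ)))
    (hmom : ∀ s ∈ Icc A (A + δ), ∀ t ∈ Icc A (A + δ), s < t →
      ∫⁻ ω, ‖X t ω - X s ω‖ₑ ^ p ∂P ≤ ENNReal.ofReal (M * (t - s) ^ q)) :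
    ∀ᵐ ω ∂P, ∃ C, 0 ≤ C ∧ ∀ x ∈ Icc A (A + δ), ∀ y ∈ Icc A (A + δ),
      |X x ω - X y ω| ≤ C * |x - y| ^ γ := by
  set r : ℝ := (1 / 2 : ℝ) ^ γ with hr
  have hr0 : 0 < r := by positivity
  let τ : ℕ → ℕ → ℝ := fun n k => A + δ * ((k : ℝ) / 2 ^ n)
  have hτ : ∀ n k, k ≤ 2 ^ n → τ n k ∈ Icc A (A + δ) := by
    intro n k hk
    have h1 : (k : ℝ) / 2 ^ n ≤ 1 := by
      rw [div_le_one (by positivity)]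
      exact_mod_cast hk
    have h2 : (0 : ℝ) ≤ (k : ℝ) / 2 ^ n := by positivity
    constructor <;> simp only [τ] <;> nlinarith
  let W : ℕ → Ω → ℝ≥0∞ := fun n ω => ∑ k ∈ Finset.range (2 ^ n),
    ENNReal.ofReal (((r ^ n)⁻¹) ^ p) * ‖X (τ n (k + 1)) ω - X (τ n k) ω‖ₑ ^ p
  have hterm : ∀ n, ∀ k ∈ Finset.range (2 ^ n), AEMeasurable
      (fun ω => ‖X (τ n (k + 1)) ω - X (τ n k) ω‖ₑ ^ p) P := by
    intro n k hk
    rw [Finset.mem_range] at hk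
    exact ((hmeas _ (hτ n (k + 1) hk)).sub (hmeas _ (hτ n k hk.le))).enorm.pow_const p
  have hWm : ∀ n, AEMeasurable (W n) P := fun n =>
    Finset.aemeasurable_fun_sum _ fun k hk => (hterm n k hk).const_mul _
  -- Per level: twice as many cells, weight `r⁻¹ ^ p`, moments smaller by `(1/2) ^ q`; hence `ρ = 2
  -- ^ (1 + γ p - q) < 1`.
  set ρ : ℝ := 2 * (r⁻¹) ^ p * (1 / 2 : ℝ) ^ q with hρ
  have hρ1 : ρ < 1 := by
    have e1 : (r⁻¹) ^ p = (2 : ℝ) ^ (γ * p) := by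
      rw [hr, one_div, Real.inv_rpow (by norm_num), inv_inv, Real.rpow_mul (by norm_num),
        Real.rpow_natCast]
    have e2 : (1 / 2 : ℝ) ^ q = (2 : ℝ) ^ (-q) := by
      rw [one_div, Real.inv_rpow (by norm_num), Real.rpow_neg (by norm_num)]
    rw [hρ, e1, e2]
    nth_rewrite 1 [← Real.rpow_one 2]
    rw [← Real.rpow_add (by norm_num), ← Real.rpow_add (by norm_num)]
    exact Real.rpow_lt_one_of_one_lt_of_neg (by norm_num) (by linarith)
  have hWint : ∀ n, ∫⁻ ω, W n ω ∂P ≤ ENNReal.ofReal (M * δ ^ q * ρ ^ n) := by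
    intro n
    rw [lintegral_finsetSum' _ fun k hk => (hterm n k hk).const_mul _]
    calc _ ≤ ∑ k ∈ Finset.range (2 ^ n), ENNReal.ofReal (((r ^ n)⁻¹) ^ p)
            * ENNReal.ofReal (M * (δ * (1 / 2) ^ n) ^ q) := by
          refine Finset.sum_le_sum fun k hk => ?_
          rw [lintegral_const_mul'' _ (hterm n k hk)]
          rw [Finset.mem_range] at hk
          have hdiff : τ n (k + 1) - τ n k = δ * (1 / 2) ^ n := by
            simp only [τ]
            push_cast
            rw [one_div, inv_pow]
            ring
          have hlt : τ n k < τ n (k + 1) := by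
            rw [← sub_pos, hdiff]
            positivity
          gcongr
          rw [← hdiff]
          exact hmom _ (hτ n k hk.le) _ (hτ n (k + 1) hk) hlt
      _ = _ := by
          rw [Finset.sum_const, Finset.card_range, nsmul_eq_mul, ← ENNReal.ofReal_mul (by positivity),
            ← ENNReal.ofReal_natCast, ← ENNReal.ofReal_mul (by positivity)]
          congr 1
          rw [hρ, Real.mul_rpow hδ.le (by positivity), ← Real.rpow_pow_comm (by norm_num), mul_pow,
            mul_pow]
          push_cast
          rw [← inv_pow, pow_right_comm]
          ring
  have hρ0 : 0 ≤ ρ := by positivity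
  have htot : ∫⁻ ω, ∑' n, W n ω ∂P ≠ ∞ := by
    rw [lintegral_tsum hWm]
    refine ne_top_of_le_ne_top ?_ (ENNReal.tsum_le_tsum hWint)
    exact ((summable_geometric_of_lt_one hρ0 hρ1).mul_left _).tsum_ofReal_ne_top
  filter_upwards [ae_lt_top' (AEMeasurable.tsum hWm) htot] with ω hω
  set S := (∑' n, W n ω).toReal with hS
  have hS0 : 0 ≤ S := ENNReal.toReal_nonneg
  have hinc : ∀ n k : ℕ, k + 1 ≤ 2 ^ n →
      |X (τ n (k + 1)) ω - X (τ n k) ω| ≤ (S + 1) * r ^ n := by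
    intro n k hk
    have h1 : ENNReal.ofReal (((r ^ n)⁻¹) ^ p) * ‖X (τ n (k + 1)) ω - X (τ n k) ω‖ₑ ^ p
        ≤ ∑' n, W n ω :=
      (Finset.single_le_sum (f := fun k => ENNReal.ofReal (((r ^ n)⁻¹) ^ p)
        * ‖X (τ n (k + 1)) ω - X (τ n k) ω‖ₑ ^ p) (fun _ _ => zero_le)
        (Finset.mem_range.2 hk)).trans (ENNReal.le_tsum n)
    rw [← ofReal_norm, ← ENNReal.ofReal_pow (norm_nonneg _), ← ENNReal.ofReal_mul (by positivity),
      ENNReal.ofReal_le_iff_le_toReal hω.ne, ← hS, ← mul_pow] at h1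
    -- `S + 1 ≥ 1` gives `S ≤ (S + 1) ^ p`, so a `p`-th root can be taken without computing one.
    have h2 : ((r ^ n)⁻¹ * ‖X (τ n (k + 1)) ω - X (τ n k) ω‖) ^ p ≤ (S + 1) ^ p := by
      refine h1.trans (le_trans (by linarith) (le_self_pow₀ (by linarith : 1 ≤ S + 1) hp))
    have h3 := le_of_pow_le_pow_left₀ hp (by linarith) h2
    rwa [inv_mul_le_iff₀ (by positivity), mul_comm, Real.norm_eq_abs] at h3
  obtain ⟨C, hC0, hC⟩ := holder_of_dyadic (f := fun x => X (A + δ * x) ω) (K := S + 1) (γ := γ)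
    ((hcont ω).comp (by fun_prop) fun x hx => ⟨by nlinarith [hx.1], by nlinarith [hx.2]⟩) hγ
    (by linarith) hinc
  refine ⟨C * (δ ^ γ)⁻¹, by positivity, fun x hx y hy => ?_⟩
  have hmem : ∀ z ∈ Icc A (A + δ), (z - A) / δ ∈ Icc (0 : ℝ) 1 := fun z hz =>
    ⟨div_nonneg (by linarith [hz.1]) hδ.le, (div_le_one hδ).2 (by linarith [hz.2])⟩
  have := hC _ (hmem x hx) _ (hmem y hy)
  simp only [mul_div_cancel₀ _ hδ.ne', add_sub_cancel] at this
  refine this.trans (le_of_eq ?_)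
  rw [← sub_div, sub_sub_sub_cancel_right, abs_div, abs_of_pos hδ,
    Real.div_rpow (abs_nonneg _) hδ.le]
  ring

/-- A centered Gaussian variable has the law of its standard deviation times a standard normal one,
also in the degenerate case. -/
theorem lintegral_enorm_pow_of_gaussian {P : Measure Ω} [IsProbabilityMeasure P] {D : Ω → ℝ}
    (hD : HasGaussianLaw D P) (h0 : ∫ ω, D ω ∂P = 0) (p : ℕ) :
    ∫⁻ ω, ‖D ω‖ₑ ^ p ∂P = ENNReal.ofReal (√(∫ ω, D ω ^ 2 ∂P)) ^ p
      * ∫⁻ x, ‖x‖ₑ ^ p ∂gaussianReal 0 1 := by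
  have hv : Var[D; P] = ∫ ω, D ω ^ 2 ∂P := by
    rw [variance_eq_integral hD.aemeasurable, h0]
    simp
  have hσ : 0 ≤ ∫ ω, D ω ^ 2 ∂P := integral_nonneg fun _ => sq_nonneg _
  have hmap : P.map D = (gaussianReal 0 1).map (√(∫ ω, D ω ^ 2 ∂P) * ·) := by
    rw [hD.map_eq_gaussianReal, gaussianReal_map_const_mul, h0, hv, mul_zero, mul_one]
    congr 1
    ext
    simp [Real.sq_sqrt hσ, hσ]
  calc _ = ∫⁻ x, ‖x‖ₑ ^ p ∂(P.map D) :=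
        (lintegral_map' (by fun_prop) hD.aemeasurable).symm
    _ = _ := by
        rw [hmap, lintegral_map (by fun_prop) (by fun_prop), ← lintegral_const_mul _ (by fun_prop)]
        refine lintegral_congr fun x => ?_
        rw [enorm_mul, mul_pow, Real.enorm_of_nonneg (Real.sqrt_nonneg _)]

theorem lintegral_enorm_pow_gaussianReal_ne_top (p : ℕ) :
    ∫⁻ x, ‖x‖ₑ ^ p ∂gaussianReal 0 1 ≠ ∞ := by
  rcases eq_or_ne p 0 with rfl | hp
  · simp
  · have := (memLp_id_gaussianReal' (μ := 0) (v := 1) p (by simp)).eLpNorm_lt_top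
    have h := (eLpNorm_lt_top_iff_lintegral_rpow_enorm_lt_top (by exact_mod_cast hp)
      (by simp)).1 this
    simpa using h.ne

/-! ### Probability of small increments. -/

theorem measure_eq_zero_of_gaussian {P : Measure Ω} {D : Ω → ℝ} (hD : HasGaussianLaw D P)
    (h0 : ∫ ω, D ω ∂P = 0) (hpos : 0 < ∫ ω, D ω ^ 2 ∂P) : P {ω | D ω = 0} = 0 := by
  have hv : Var[D; P].toNNReal ≠ 0 := by
    rw [variance_eq_integral hD.aemeasurable, h0]
    simpa using hpos
  have := nullSingletonClass_gaussianReal (μ := P[D]) hv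
  have h1 : P.map D {0} = 0 := by
    rw [hD.map_eq_gaussianReal]
    exact measure_singleton 0
  rwa [Measure.map_apply_of_aemeasurable hD.aemeasurable (measurableSet_singleton 0)] at h1

/-- Continuity from above along `{|D| < 1 / (n + 1)}`, which decreases to the null set `{D = 0}`. It
supplies the thresholds for Borel–Cantelli. -/
theorem exists_measure_abs_lt_le {P : Measure Ω} [IsProbabilityMeasure P] {D : Ω → ℝ}
    (hD : AEMeasurable D P) (h0 : P {ω | D ω = 0} = 0) {η : ℝ≥0∞} (hη : 0 < η) :
    ∃ ε : ℝ, 0 < ε ∧ P {ω | |D ω| < ε} ≤ η := by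
  have hanti : Antitone fun n : ℕ => {ω | |D ω| < 1 / ((n : ℝ) + 1)} := by
    intro m n hmn ω hω
    exact lt_of_lt_of_le (b := 1 / ((n : ℝ) + 1)) hω (Nat.one_div_le_one_div hmn)
  have hlim := tendsto_measure_iInter_atTop (μ := P)
    (s := fun n : ℕ => {ω | |D ω| < 1 / ((n : ℝ) + 1)})
    (fun n => nullMeasurableSet_lt (by fun_prop) aemeasurable_const) hanti
    ⟨0, measure_ne_top _ _⟩
  have hinter : ⋂ n : ℕ, {ω | |D ω| < 1 / ((n : ℝ) + 1)} = {ω | D ω = 0} := by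
    ext ω
    simp only [mem_iInter, mem_ofPred_eq]
    refine ⟨fun h => ?_, fun h n => by rw [h, abs_zero]; exact Nat.one_div_pos_of_nat⟩
    by_contra hne
    obtain ⟨n, hn⟩ := exists_nat_one_div_lt (abs_pos.2 hne)
    exact absurd (h n) hn.le.not_gt
  rw [hinter, h0] at hlim
  obtain ⟨n, hn⟩ := (hlim.eventually (gt_mem_nhds hη)).exists
  exact ⟨_, Nat.one_div_pos_of_nat, hn.le⟩

/-! ### Properties of the class of Gaussian processes -/

theorem IsCenteredContGaussian.hasGaussianLaw_sub {P : Measure Ω} {T : ℝ} {X : ℝ → Ω → ℝ}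
    (h : IsCenteredContGaussian P T X) {s t : ℝ} (hs : s ∈ Icc 0 T) (ht : t ∈ Icc 0 T) :
    HasGaussianLaw (fun ω => X t ω - X s ω) P :=
  h.gaussian.hasGaussianLaw_fun_sub (s := ⟨t, ht⟩) (t := ⟨s, hs⟩)

theorem IsCenteredContGaussian.integral_sub_eq_zero {P : Measure Ω} {T : ℝ} {X : ℝ → Ω → ℝ}
    (h : IsCenteredContGaussian P T X) {s t : ℝ} (hs : s ∈ Icc 0 T) (ht : t ∈ Icc 0 T) :
    ∫ ω, (X t ω - X s ω) ∂P = 0 := by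
  have h1 := (h.gaussian.hasGaussianLaw_eval ⟨t, ht⟩).integrable
  have h2 := (h.gaussian.hasGaussianLaw_eval ⟨s, hs⟩).integrable
  rw [integral_sub h1 h2, h.centered t ht, h.centered s hs, sub_zero]

/-- For Gaussian increments the variance bound gives `p`-th moments of order `(t - s) ^ (α * p)` for
every `p`, and `α * p > 1 + γ * p` once `p > 1 / (α - γ)`. -/
theorem IsCenteredContGaussian.ae_holder {P : Measure Ω} [IsProbabilityMeasure P] {T α γ δ : ℝ}
    {X : ℝ → Ω → ℝ} (h : IsCenteredContGaussian P T X) (hδ : 0 < δ) (hδT : δ ≤ T) (hγ : 0 < γ)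
    (hγα : γ < α) (hX : CovarianceConditions P α δ (incProc X (T - δ))) :
    ∀ᵐ ω ∂P, ∃ C, 0 ≤ C ∧ ∀ x ∈ Icc (T - δ) T, ∀ y ∈ Icc (T - δ) T,
      |X x ω - X y ω| ≤ C * |x - y| ^ γ := by
  obtain ⟨C, hC, hCv⟩ := hX.incVar_le
  obtain ⟨p, hp⟩ := exists_nat_gt (1 / (α - γ))
  have hαγ : 0 < α - γ := sub_pos.2 hγα
  have hp0 : p ≠ 0 := by
    rintro rfl
    have := one_div_pos.2 hαγ
    simp at hp
    linarith
  have hsub : Icc (T - δ) T ⊆ Icc 0 T := Icc_subset_Icc_left (by linarith)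
  set m := (∫⁻ x, ‖x‖ₑ ^ p ∂gaussianReal 0 1).toReal with hm
  have key := ae_holder_of_moments (P := P) (X := X) (A := T - δ) (δ := δ) (γ := γ) (q := α * p)
    (M := √C ^ p * m) (p := p) hδ hγ hp0 ?_ ?_ ?_ ?_
  · simpa only [sub_add_cancel] using key
  · rw [div_lt_iff₀ hαγ] at hp
    linarith
  · rw [sub_add_cancel]
    exact fun t ht => h.gaussian.aemeasurable ⟨t, hsub ht⟩
  · rw [sub_add_cancel]
    exact fun ω => (h.continuous ω).mono hsub
  · rw [sub_add_cancel]
    intro s hs t ht hst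
    have hts : 0 < t - s := sub_pos.2 hst
    rw [lintegral_enorm_pow_of_gaussian (h.hasGaussianLaw_sub (hsub hs) (hsub ht))
      (h.integral_sub_eq_zero (hsub hs) (hsub ht)),
      ← ENNReal.ofReal_toReal (lintegral_enorm_pow_gaussianReal_ne_top p), ← hm,
      ← ENNReal.ofReal_pow (Real.sqrt_nonneg _), ← ENNReal.ofReal_mul (by positivity)]
    refine ENNReal.ofReal_le_ofReal ?_
    have hv := hCv (t - s) ⟨hts.le, by linarith [hs.1, ht.2]⟩ (s - (T - δ))
      ⟨by linarith [hs.1], by linarith [ht.2]⟩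
    have hv' : ∫ ω, (X t ω - X s ω) ^ 2 ∂P ≤ C * (t - s) ^ (2 * α) := by
      refine le_of_eq_of_le ?_ hv
      simp [incVar, incProc]
    have e : (t - s) ^ (α * p) = (√((t - s) ^ (2 * α))) ^ p := by
      rw [Real.sqrt_eq_rpow, ← Real.rpow_natCast, ← Real.rpow_mul hts.le, ← Real.rpow_mul hts.le]
      congr 1
      ring
    rw [e]
    calc _ ≤ √(C * (t - s) ^ (2 * α)) ^ p * m := by gcongr
      _ = _ := by
        rw [Real.sqrt_mul hC.le]
        ring

/-- Positivity of the covariance on the diagonal is positivity of the variance, so the Gaussian law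
has no atom. -/
theorem IsCenteredContGaussian.measure_sub_eq_zero {P : Measure Ω} {T α u t : ℝ}
    {X : ℝ → Ω → ℝ} (h : IsCenteredContGaussian P T X) (hu : 0 ≤ u) (hut : u < t) (htT : t ≤ T)
    (hX : CovarianceConditions P α (T - u) (incProc X u)) : P {ω | X t ω - X u ω = 0} = 0 := by
  have h1 : u ∈ Icc 0 T := ⟨hu, hut.le.trans htT⟩
  have h2 : t ∈ Icc 0 T := ⟨hu.trans hut.le, htT⟩
  have hm : t - u ∈ Ioc 0 (T - u) := ⟨sub_pos.2 hut, by linarith⟩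
  refine measure_eq_zero_of_gaussian (h.hasGaussianLaw_sub h1 h2) (h.integral_sub_eq_zero h1 h2) ?_
  have := hX.cov_pos _ hm _ hm
  simpa [cov, incProc, ← sq] using this

/-! ### The strategy

The interval `[T - δ, T)` is cut into blocks by the times `T - δ / (n + 1)`, and the `n`-th block
into `N n` cells of equal length. On each cell the strategy holds `2 a_n` times the increment of the
path since the beginning of the block, so that its gain over a block is `a_n` times the squared
increment over the block, less `a_n` times the quadratic variation along the cells. -/

/-- The times that cut `[T - δ, T)` into blocks. -/
noncomputable def blockTime (T δ : ℝ) (n : ℕ) : ℝ := T - δ / ((n : ℝ) + 1)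

/-- The times that cut the `n`-th block into `N n` cells of equal length. -/
noncomputable def gridTime (T δ : ℝ) (N : ℕ → ℕ) (n j : ℕ) : ℝ :=
  blockTime T δ n + j * ((blockTime T δ (n + 1) - blockTime T δ n) / N n)

/-- The strategy on the `n`-th block, along the path `g`. -/
noncomputable def blockStrategy (T δ : ℝ) (N : ℕ → ℕ) (a : ℕ → ℝ) (g : ℝ → ℝ) (n : ℕ) (r : ℝ) : ℝ :=
  ∑ j ∈ Finset.range (N n), 2 * a n * (g (gridTime T δ N n j) - g (blockTime T δ n))
    * (Ico (gridTime T δ N n j) (gridTime T δ N n (j + 1))).indicator (fun _ => 1) r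

/-- The strategy along the path `g`. Only the first `⌈δ / (T - r)⌉₊` blocks begin before or at
time `r`. -/
noncomputable def strategy (T δ : ℝ) (N : ℕ → ℕ) (a : ℕ → ℝ) (g : ℝ → ℝ) (r : ℝ) : ℝ :=
  ∑ n ∈ Finset.range ⌈δ / (T - r)⌉₊, blockStrategy T δ N a g n r

/-! ### Block and cell times, locality and adaptedness of the strategy. -/

section Times

variable {T δ : ℝ} {N : ℕ → ℕ}

theorem blockTime_lt_succ (hδ : 0 < δ) (n : ℕ) : blockTime T δ n < blockTime T δ (n + 1) := by
  unfold blockTime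
  push_cast
  gcongr
  linarith

theorem blockTime_mono (hδ : 0 < δ) : Monotone (blockTime T δ) :=
  monotone_nat_of_le_succ fun n => (blockTime_lt_succ hδ n).le

theorem blockTime_lt (hδ : 0 < δ) (n : ℕ) : blockTime T δ n < T := by
  unfold blockTime
  have : 0 < δ / ((n : ℝ) + 1) := by positivity
  linarith

theorem le_blockTime (hδ : 0 < δ) (n : ℕ) : T - δ ≤ blockTime T δ n := by
  have := blockTime_mono (T := T) hδ (Nat.zero_le n)
  simpa [blockTime] using this

theorem gridTime_zero (n : ℕ) : gridTime T δ N n 0 = blockTime T δ n := by simp [gridTime]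

theorem gridTime_card {n : ℕ} (hN : 0 < N n) : gridTime T δ N n (N n) = blockTime T δ (n + 1) := by
  have : (N n : ℝ) ≠ 0 := by exact_mod_cast hN.ne'
  rw [gridTime, mul_div_cancel₀ _ this, add_sub_cancel]

theorem gridTime_mono (hδ : 0 < δ) (n : ℕ) : Monotone (gridTime T δ N n) := by
  intro i j hij
  have := (blockTime_lt_succ (T := T) hδ n).le
  unfold gridTime
  gcongr

theorem gridTime_succ_sub (n j : ℕ) : gridTime T δ N n (j + 1) - gridTime T δ N n j
    = (blockTime T δ (n + 1) - blockTime T δ n) / N n := by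
  unfold gridTime
  push_cast
  ring

theorem blockTime_le_gridTime (hδ : 0 < δ) (n j : ℕ) : blockTime T δ n ≤ gridTime T δ N n j := by
  rw [← gridTime_zero (N := N)]
  exact gridTime_mono hδ n (Nat.zero_le j)

theorem blockStrategy_eq_zero (hδ : 0 < δ) {a : ℕ → ℝ} {g : ℝ → ℝ} {n : ℕ} {r : ℝ}
    (hr : r < blockTime T δ n) : blockStrategy T δ N a g n r = 0 := by
  refine Finset.sum_eq_zero fun j _ => ?_
  rw [indicator_of_notMem, mul_zero]
  exact fun h => absurd (h.1.trans_lt hr) (blockTime_le_gridTime hδ n j).not_gt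

theorem lt_blockTime_of_ceil_le {r : ℝ} (hr : r < T) {n : ℕ} (hn : ⌈δ / (T - r)⌉₊ ≤ n) :
    r < blockTime T δ n := by
  have h1 : δ / (T - r) < n + 1 := (Nat.ceil_le.1 hn).trans_lt (lt_add_one _)
  have h2 : δ / ((n : ℝ) + 1) < T - r := by
    rw [div_lt_iff₀ (sub_pos.2 hr)] at h1
    rw [div_lt_iff₀ (by positivity)]
    linarith
  unfold blockTime
  linarith

/-- Blocks of index at least `⌈δ / (T - s)⌉₊` begin after `s`, so a single cutoff serves all `r ≤ s`
and may be enlarged freely. -/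
theorem strategy_eq_sum (hδ : 0 < δ) {a : ℕ → ℝ} {g : ℝ → ℝ} {r s : ℝ} (hrs : r ≤ s) (hs : s < T)
    {M : ℕ} (hM : ⌈δ / (T - s)⌉₊ ≤ M) :
    strategy T δ N a g r = ∑ n ∈ Finset.range M, blockStrategy T δ N a g n r := by
  have hle : ⌈δ / (T - r)⌉₊ ≤ M := by
    refine le_trans (Nat.ceil_le_ceil ?_) hM
    have := sub_pos.2 hs
    gcongr
  refine Finset.sum_subset (Finset.range_subset_range.2 hle) fun n _ hn => ?_
  exact blockStrategy_eq_zero hδ (lt_blockTime_of_ceil_le (hrs.trans_lt hs) (by simpa using hn))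

theorem strategy_eq_zero (hδ : 0 < δ) {a : ℕ → ℝ} {g : ℝ → ℝ} {r : ℝ} (hr : r < T - δ) :
    strategy T δ N a g r = 0 :=
  Finset.sum_eq_zero fun n _ => blockStrategy_eq_zero hδ (hr.trans_le (le_blockTime hδ n))

/-- A cell contributes at time `t` only if it contains `t`, and then both path values used are from
times up to `t`. At `t = T` the sum is empty, since `δ / 0 = 0`. -/
theorem adapted_strategy (hδ : 0 < δ) (hδT : δ ≤ T) {𝔽 : Filtration (Icc (0 : ℝ) T) mΩ}
    {X : ℝ → Ω → ℝ} (hX : Adapted 𝔽 fun t : Icc (0 : ℝ) T => X t) (a : ℕ → ℝ) :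
    Adapted 𝔽 fun (t : Icc (0 : ℝ) T) ω => strategy T δ N a (fun r => X r ω) t := by
  intro t
  refine Finset.measurable_fun_sum _ fun n _ => Finset.measurable_fun_sum _ fun j _ => ?_
  by_cases h : (t : ℝ) ∈ Ico (gridTime T δ N n j) (gridTime T δ N n (j + 1))
  · have hbg := blockTime_le_gridTime (T := T) (N := N) hδ n j
    have hb0 : 0 ≤ blockTime T δ n := le_trans (by linarith) (le_blockTime hδ n)
    have hmeas : ∀ u : ℝ, 0 ≤ u → u ≤ t → Measurable[𝔽 t] (X u) := fun u hu hut =>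
      hX.measurable_le (i := ⟨u, hu, hut.trans t.2.2⟩) (j := t) hut
    exact (((hmeas _ (hb0.trans hbg) h.1).sub (hmeas _ hb0 (hbg.trans h.1))).const_mul _).mul_const _
  · simp only [indicator_of_notMem h, mul_zero]
    exact measurable_const

/-! ### The gain of the strategy -/

/-- The gain of the strategy on the `n`-th block up to time `s`, for unit weight. -/
noncomputable def blockGain (T δ : ℝ) (N : ℕ → ℕ) (g : ℝ → ℝ) (n : ℕ) (s : ℝ) : ℝ :=
  ∑ j ∈ Finset.range (N n), 2 * (g (gridTime T δ N n j) - g (blockTime T δ n))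
    * (g (min (gridTime T δ N n (j + 1)) s) - g (min (gridTime T δ N n j) s))

theorem hasGLSIntegral_blockStrategy {β lam K s : ℝ} (h0 : 0 < β) (h1 : β < 1)
    (hl : 0 < lam + β - 1) (hδ : 0 < δ) (hδT : δ ≤ T) (hs : 0 ≤ s) {g G : ℝ → ℝ}
    (hK : ∀ x y, |G x - G y| ≤ K * |x - y| ^ lam) (hG : EqOn g G (Icc (T - δ) s)) (a : ℕ → ℝ)
    (n : ℕ) :
    HasGLSIntegral β s (blockStrategy T δ N a g n) g (a n * blockGain T δ N g n s) := by
  have := HasGLSIntegral.sum hs (Finset.range (N n)) fun j _ =>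
    (hasGLSIntegral_indicator_Ico h0 h1 hl (sub_nonneg.2 hδT)
      ((le_blockTime hδ n).trans (blockTime_le_gridTime (N := N) hδ n j))
      (gridTime_mono hδ n j.le_succ) hs hK hG).const_mul
        (2 * a n * (g (gridTime T δ N n j) - g (blockTime T δ n)))
  convert! this using 1
  rw [blockGain, Finset.mul_sum]
  exact Finset.sum_congr rfl fun j _ => by ring

/-- Telescoping of `2 x (y - x) = y² - x² - (y - x)²`, each cell losing at most `(K ℓ ^ γ)²`.
Stopping at `s` keeps the bound valid in unfinished and future blocks. -/
theorem le_blockGain {γ K s : ℝ} (hγ : 0 < γ) (hδ : 0 < δ) (hK0 : 0 ≤ K) {g : ℝ → ℝ} {n : ℕ}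
    (hN : 0 < N n) (hs : s ∈ Icc (T - δ) T)
    (hK : ∀ x ∈ Icc (T - δ) T, ∀ y ∈ Icc (T - δ) T, |g x - g y| ≤ K * |x - y| ^ γ) :
    (g (min (blockTime T δ (n + 1)) s) - g (min (blockTime T δ n) s)) ^ 2
      - K ^ 2 * (N n * (((blockTime T δ (n + 1) - blockTime T δ n) / N n) ^ γ) ^ 2)
      ≤ blockGain T δ N g n s := by
  set ℓ := (blockTime T δ (n + 1) - blockTime T δ n) / N n with hℓ
  set τ := gridTime T δ N n with hτ
  let x : ℕ → ℝ := fun j => g (min (τ j) s) - g (min (τ 0) s)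
  have hterm : ∀ j ∈ Finset.range (N n), (x (j + 1) ^ 2 - x j ^ 2) - (K * ℓ ^ γ) ^ 2
      ≤ 2 * (g (τ j) - g (τ 0)) * (g (min (τ (j + 1)) s) - g (min (τ j) s)) := by
    intro j hj
    rw [Finset.mem_range] at hj
    have hτs : τ j ≤ τ (j + 1) := gridTime_mono hδ n j.le_succ
    have hmem : ∀ i ≤ N n, min (τ i) s ∈ Icc (T - δ) T := fun i _ =>
      ⟨le_min ((le_blockTime hδ n).trans (blockTime_le_gridTime hδ n i)) hs.1,
        (min_le_right _ _).trans hs.2⟩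
    have hsq : (x (j + 1) - x j) ^ 2 ≤ (K * ℓ ^ γ) ^ 2 := by
      rw [← sq_abs (x (j + 1) - x j)]
      gcongr
      have : x (j + 1) - x j = g (min (τ (j + 1)) s) - g (min (τ j) s) := by simp only [x]; ring
      rw [this]
      refine (hK _ (hmem _ hj) _ (hmem _ hj.le)).trans ?_
      gcongr
      rw [hℓ, ← gridTime_succ_sub n j, ← hτ]
      rw [abs_of_nonneg (sub_nonneg.2 (min_le_min_right s hτs))]
      rcases le_total (τ j) s with h | h
      · rw [min_eq_left h]
        linarith [min_le_left (τ (j + 1)) s]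
      · rw [min_eq_right h, min_eq_right (h.trans hτs)]
        linarith
    -- The first factor is not stopped at `s`, which is harmless: if `s ≤ τ j`, the stopped
    -- increment is zero.
    have hid : 2 * (g (τ j) - g (τ 0)) * (g (min (τ (j + 1)) s) - g (min (τ j) s))
        = (x (j + 1) ^ 2 - x j ^ 2) - (x (j + 1) - x j) ^ 2 := by
      rcases le_total (τ j) s with h | h
      · have h' : τ 0 ≤ s := (gridTime_mono hδ n (Nat.zero_le j)).trans h
        simp only [x, min_eq_left h, min_eq_left h']
        ring
      · simp only [x, min_eq_right h, min_eq_right (h.trans hτs)]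
        ring
    rw [hid]
    linarith
  have hsum := Finset.sum_le_sum hterm
  rw [Finset.sum_sub_distrib, Finset.sum_range_sub (fun j => x j ^ 2), Finset.sum_const,
    Finset.card_range, nsmul_eq_mul] at hsum
  have hx0 : x 0 = 0 := sub_self _
  have hxN : x (N n) = g (min (blockTime T δ (n + 1)) s) - g (min (blockTime T δ n) s) := by
    simp only [x, hτ, gridTime_card hN, gridTime_zero]
  have hτ0 : τ 0 = blockTime T δ n := gridTime_zero n
  rw [hx0, hxN, hτ0] at hsum
  unfold blockGain
  rw [← hτ]
  refine le_of_eq_of_le ?_ hsum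
  ring

/-- `N (L / N) ^ (2γ) = L ^ (2γ) N ^ (1 - 2γ)` tends to zero because `γ > 1/2`. -/
theorem exists_fine_mesh {γ : ℝ} (hγ : 1 / 2 < γ) {L η : ℝ} (hL : 0 < L) (hη : 0 < η) (a : ℝ) :
    ∃ N : ℕ, 0 < N ∧ a * (N * ((L / N) ^ γ) ^ 2) ≤ η := by
  have h1 : Tendsto (fun N : ℕ => a * (L ^ γ) ^ 2 * (N : ℝ) ^ (-(2 * γ - 1))) atTop (𝓝 0) := by
    simpa using ((tendsto_rpow_neg_atTop (by linarith : 0 < 2 * γ - 1)).comp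
      tendsto_natCast_atTop_atTop).const_mul (a * (L ^ γ) ^ 2)
  obtain ⟨N, hN, hN0⟩ := ((h1.eventually (gt_mem_nhds hη)).and (eventually_gt_atTop 0)).exists
  refine ⟨N, hN0, le_trans (le_of_eq ?_) hN.le⟩
  have hNr : (0 : ℝ) < N := by exact_mod_cast hN0
  rw [Real.div_rpow hL.le hNr.le, div_pow, show -(2 * γ - 1) = 1 - γ * (2 : ℕ) by push_cast; ring,
    Real.rpow_sub hNr, Real.rpow_one, Real.rpow_mul hNr.le, Real.rpow_natCast]
  ring

/-- Along a Hölder path whose increments over the blocks are eventually not small, the gain of the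
strategy tends to infinity. -/
theorem tendsto_sum_blockGain {γ K : ℝ} (hγ : 0 < γ) (hδ : 0 < δ) (hK0 : 0 ≤ K) {g : ℝ → ℝ}
    {ε : ℕ → ℝ} (hε : ∀ n, 0 < ε n) (hN : ∀ n, 0 < N n)
    (hmesh : ∀ n, (ε n ^ 2)⁻¹ * (N n *
      (((blockTime T δ (n + 1) - blockTime T δ n) / N n) ^ γ) ^ 2) ≤ (1 / 2) ^ n)
    (hK : ∀ x ∈ Icc (T - δ) T, ∀ y ∈ Icc (T - δ) T, |g x - g y| ≤ K * |x - y| ^ γ)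
    (hinc : ∀ᶠ n in atTop, ε n ≤ |g (blockTime T δ (n + 1)) - g (blockTime T δ n)|) {I : ℝ → ℝ}
    (hI : ∀ s ∈ Ico (T - δ) T, ∀ M, ⌈δ / (T - s)⌉₊ ≤ M →
      I s = ∑ n ∈ Finset.range M, (ε n ^ 2)⁻¹ * blockGain T δ N g n s) :
    Tendsto I (𝓝[<] T) atTop := by
  obtain ⟨n₀, hn₀⟩ := eventually_atTop.1 hinc
  refine tendsto_atTop.2 fun b => ?_
  -- After the block time of index `n₀ + m`, the `m` finished blocks from `n₀` on contribute at
  -- least one each, while all losses together are at most `2 * K ^ 2`.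
  obtain ⟨m, hm⟩ := exists_nat_gt (b + 2 * K ^ 2)
  have hlt := blockTime_lt (T := T) hδ (n₀ + m)
  filter_upwards [Ioo_mem_nhdsLT hlt] with s hs
  have hsA : T - δ ≤ s := (le_blockTime hδ _).trans hs.1.le
  set M := max ⌈δ / (T - s)⌉₊ (n₀ + m)
  rw [hI s ⟨hsA, hs.2⟩ M (le_max_left _ _)]
  have hlow : ∀ n ∈ Finset.range M,
      (ε n ^ 2)⁻¹ * (g (min (blockTime T δ (n + 1)) s) - g (min (blockTime T δ n) s)) ^ 2
        - K ^ 2 * (1 / 2) ^ n ≤ (ε n ^ 2)⁻¹ * blockGain T δ N g n s := by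
    intro n _
    have h1 := le_blockGain hγ hδ hK0 (hN n) ⟨hsA, hs.2.le⟩ hK
    have h2 : 0 ≤ (ε n ^ 2)⁻¹ := by positivity
    have h3 := mul_le_mul_of_nonneg_left h1 h2
    have h4 := mul_le_mul_of_nonneg_left (hmesh n) (sq_nonneg K)
    linarith
  have hgeo : ∑ n ∈ Finset.range M, K ^ 2 * (1 / 2 : ℝ) ^ n ≤ 2 * K ^ 2 := by
    rw [← Finset.mul_sum, mul_comm 2]
    gcongr
    exact sum_geometric_two_le M
  have hbig : (m : ℝ) ≤ ∑ n ∈ Finset.range M, (ε n ^ 2)⁻¹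
      * (g (min (blockTime T δ (n + 1)) s) - g (min (blockTime T δ n) s)) ^ 2 := by
    calc (m : ℝ) = ∑ n ∈ Finset.Ico n₀ (n₀ + m), (1 : ℝ) := by simp
      _ ≤ ∑ n ∈ Finset.Ico n₀ (n₀ + m), (ε n ^ 2)⁻¹
          * (g (min (blockTime T δ (n + 1)) s) - g (min (blockTime T δ n) s)) ^ 2 := by
        refine Finset.sum_le_sum fun n hn => ?_
        rw [Finset.mem_Ico] at hn
        have h1 : blockTime T δ (n + 1) ≤ s := (blockTime_mono hδ hn.2).trans hs.1.le
        have h2 : blockTime T δ n ≤ s := (blockTime_lt_succ hδ n).le.trans h1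
        rw [min_eq_left h1, min_eq_left h2, ← sq_abs (g _ - g _), le_inv_mul_iff₀ (pow_pos (hε n) 2), mul_one]
        exact pow_le_pow_left₀ (hε n).le (hn₀ n hn.1) 2
      _ ≤ _ := by
        refine Finset.sum_le_sum_of_subset_of_nonneg (fun n hn => ?_) fun n _ _ => by positivity
        rw [Finset.mem_Ico] at hn
        exact Finset.mem_range.2 (hn.2.trans_le (le_max_right _ _))
  have := Finset.sum_le_sum hlow
  rw [Finset.sum_sub_distrib] at this
  linarith

/-- Along a Hölder path the gain of the strategy exists as a generalized Lebesgue–Stieltjes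
integral. -/
theorem hasGLSIntegral_sum_blockStrategy {β γ K s : ℝ} (hβ : β ∈ Ioo (0 : ℝ) 1)
    (hl : 0 < γ + β - 1) (hδ : 0 < δ) (hδT : δ ≤ T) (hK0 : 0 ≤ K) {g : ℝ → ℝ} (hs : s ∈ Ico 0 T)
    (hK : ∀ x ∈ Icc (T - δ) T, ∀ y ∈ Icc (T - δ) T, |g x - g y| ≤ K * |x - y| ^ γ) (a : ℕ → ℝ)
    (M : ℕ) :
    HasGLSIntegral β s (fun r => ∑ n ∈ Finset.range M, blockStrategy T δ N a g n r) g
      (∑ n ∈ Finset.range M, a n * blockGain T δ N g n s) := by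
  obtain ⟨G, hG, hgG⟩ := exists_holder_extension (g := g) (by linarith)
    (by linarith [hβ.2] : 0 < γ) hK0 hK
  exact HasGLSIntegral.sum hs.1 _ fun n _ => hasGLSIntegral_blockStrategy hβ.1 hβ.2
    hl hδ hδT hs.1 hG (hgG.mono (Icc_subset_Icc_right hs.2.le)) a n

/-- The path is Hölder only on `[T - δ, T]`, and the strategy vanishes before. Hence `min (T - δ) s`
as the starting point; for `s ≤ T - δ` the interval left for the integrator is a single point. -/
theorem glsIntegrable_strategy {β γ K s : ℝ} (hβ : β ∈ Ioo (0 : ℝ) 1)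
    (hl : 0 < γ + β - 1) (hδ : 0 < δ) (hδT : δ ≤ T) (hK0 : 0 ≤ K) {g : ℝ → ℝ} (hs : s ∈ Ico 0 T)
    (hg : ContinuousOn g (Icc 0 T))
    (hK : ∀ x ∈ Icc (T - δ) T, ∀ y ∈ Icc (T - δ) T, |g x - g y| ≤ K * |x - y| ^ γ) (a : ℕ → ℝ) :
    GLSIntegrable β s (strategy T δ N a g) g := by
  refine (hasGLSIntegral_sum_blockStrategy (N := N) hβ hl hδ hδT hK0 hs hK a
    ⌈δ / (T - s)⌉₊).glsIntegrable (a := min (T - δ) s)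
    hβ (fun r hr => strategy_eq_sum hδ hr.2 hs.2 le_rfl)
    (hg.mono (Icc_subset_Icc_right hs.2.le)) ⟨le_min (sub_nonneg.2 hδT) hs.1, min_le_right _ _⟩
    (fun r hr => strategy_eq_zero hδ (hr.2.trans_le (min_le_left _ _))) ?_
  refine besovNorm₁_lt_top (K := K) (lam := γ) hβ.2 hl hK0 fun x hx y hy => ?_
  rcases le_total (T - δ) s with h | h
  · rw [min_eq_left h] at hx hy
    exact hK x ⟨hx.1, hx.2.trans hs.2.le⟩ y ⟨hy.1, hy.2.trans hs.2.le⟩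
  · rw [min_eq_right h] at hx hy
    rw [le_antisymm hx.2 hx.1, le_antisymm hy.2 hy.1]
    simp [Real.zero_rpow (by linarith [hβ.2] : 0 < γ).ne']

end Times

end GaussianRep

/-! ### Choice of the parameters and conclusion. -/

theorem lemma3p1 {Ω : Type*} {mΩ : MeasurableSpace Ω} (P : Measure Ω) [IsProbabilityMeasure P]
    (T α : ℝ) (hT : 0 < T) (hα : 1 / 2 < α) (hα' : α < 1)
    (𝔽 : Filtration (Icc (0 : ℝ) T) mΩ) (X : ℝ → Ω → ℝ)
    (hadapted : Adapted 𝔽 (fun t : Icc (0 : ℝ) T => X t))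
    (hX : GaussianRep.ClassX P α T X) (hsb : GaussianRep.SmallBall P α T X) :
    ∃ φ : ℝ → Ω → ℝ, Adapted 𝔽 (fun t : Icc (0 : ℝ) T => φ t) ∧
      ∃ β ∈ Ioo (0 : ℝ) 1, ∀ᵐ ω ∂P,
        (∀ s ∈ Ico (0 : ℝ) T,
          GaussianRep.GLSIntegrable β s (fun r => φ r ω) (fun r => X r ω)) ∧
        Tendsto (fun s => GaussianRep.glsIntegral β s (fun r => φ r ω) (fun r => X r ω))
          (𝓝[<] T) atTop := by
  open GaussianRep in
  obtain ⟨δ, hδ, hδT, hcond⟩ := hX.conditions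
  obtain ⟨γ, hγ, hγα⟩ := exists_between hα
  have hγ0 : 0 < γ := by linarith
  have hA0 : 0 ≤ T - δ := sub_nonneg.2 hδT
  have hnull : ∀ n, P {ω | X (blockTime T δ (n + 1)) ω - X (blockTime T δ n) ω = 0} = 0 := fun n =>
    hX.base.measure_sub_eq_zero (hA0.trans (le_blockTime hδ n)) (blockTime_lt_succ hδ n)
      (blockTime_lt hδ _).le (hcond _ ⟨le_blockTime hδ n, blockTime_lt hδ n⟩)
  have hmem : ∀ n, blockTime T δ n ∈ Icc 0 T := fun n =>
    ⟨hA0.trans (le_blockTime hδ n), (blockTime_lt hδ n).le⟩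
  choose ε hε hPε using fun n : ℕ => exists_measure_abs_lt_le
    (hX.base.hasGaussianLaw_sub (hmem n) (hmem (n + 1))).aemeasurable (hnull n)
    (η := ENNReal.ofReal ((1 / 2) ^ n)) (by positivity)
  -- The mesh is deterministic and ignores the random Hölder constant, which only multiplies the
  -- summable errors.
  choose N hN hmesh using fun n : ℕ => exists_fine_mesh hγ
    (sub_pos.2 (blockTime_lt_succ (T := T) hδ n)) (show (0 : ℝ) < (1 / 2) ^ n by positivity)
    (ε n ^ 2)⁻¹
  have hBC := ae_eventually_notMem (ne_top_of_le_ne_top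
    (summable_geometric_two.tsum_ofReal_ne_top) (ENNReal.tsum_le_tsum hPε))
  have hhol := hX.base.ae_holder hδ hδT hγ0 hγα (by
    have := hcond (T - δ) ⟨le_rfl, by linarith⟩
    rwa [sub_sub_cancel] at this)
  -- Any order in `(1 - γ, 1)` would do; `1 / 2` qualifies because `γ > 1/2`.
  have hβ : (1 / 2 : ℝ) ∈ Ioo (0 : ℝ) 1 := ⟨by norm_num, by norm_num⟩
  have hφ := adapted_strategy (N := N) hδ hδT hadapted fun n => (ε n ^ 2)⁻¹
  refine ⟨fun r ω => strategy T δ N (fun n => (ε n ^ 2)⁻¹) (fun u => X u ω) r, hφ, 1 / 2, hβ, ?_⟩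
  filter_upwards [hBC, hhol] with ω hω ⟨K, hK0, hK⟩
  have hl : 0 < γ + 1 / 2 - 1 := by linarith
  refine ⟨fun s hs => glsIntegrable_strategy hβ hl hδ hδT hK0 hs (hX.base.continuous ω) hK _,
    tendsto_sum_blockGain hγ0 hδ hK0 hε hN hmesh hK (hω.mono fun n hn => not_lt.1 hn)
      fun s hs M hM => ?_⟩
  have hs0 : s ∈ Ico 0 T := ⟨hA0.trans hs.1, hs.2⟩
  exact (hasGLSIntegral_sum_blockStrategy hβ hl hδ hδT hK0 hs0 hK _ M).glsIntegral_eq hs0.1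
    fun r hr => strategy_eq_sum hδ hr.2 hs.2 hM
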